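/- Let $\mu\in(-1/2,\infty)\setminus\{0\}$. Notation: $\mathbb N_0=\{0,1,2,\dots\}$, $(a)_n=a(a+1)\cdots(a+n-1)$, ${}_2F_1$ is the Gauss hypergeometric function; all powers are principal unless said otherwise, and $(z^2-1)^a:=(z-1)^a(z+1)^a$. For $x\in\mathbb C$ and $n\in\mathbb N_0$ the Gegenbauer polynomial is $$C_n^\mu(x)=\frac{(2\mu)_n}{n!}\,{}_2F_1\Big(-n,n+2\mu;\mu+\tfrac12;\tfrac{1-x}{2}\Big).$$ For complex $\alpha,\beta$ with $\alpha+\beta+1\notin-\mathbb N_0$ and $\alpha+\frac32\notin-\mathbb N_0$, the associated Legendre function of the second kind $Q_\alpha^\beta$ is the analytic function on $\mathbb C\setminus(-\infty,1]$ which for $|z|>1$ is given by $$Q_\alpha^\beta(z)=\frac{\sqrt\pi\,e^{i\pi\beta}\,\Gamma(\alpha+\beta+1)\,(z^2-1)^{\beta/2}}{2^{\alpha+1}\,\Gamma(\alpha+\frac32)\,z^{\alpha+\beta+1}}\;{}_2F_1\Big(\tfrac{\alpha+\beta+2}{2},\tfrac{\alpha+\beta+1}{2};\alpha+\tfrac32;\tfrac1{z^2}\Big).$$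 **Theorem.** (i) Let $\nu\in\mathbb C\setminus(-\mathbb N_0)$, let $z\in\mathbb C\setminus(-\infty,1]$ lie on an ellipse with foci $\pm1$, and let $x\in\mathbb C$ be a point in the interior of that ellipse. Then $$\frac1{(z-x)^\nu}=\frac{2^{\mu+1/2}\,\Gamma(\mu)\,e^{i\pi(\mu-\nu+1/2)}}{\sqrt\pi\,\Gamma(\nu)\,(z^2-1)^{(\nu-\mu)/2-1/4}}\sum_{n=0}^\infty(n+\mu)\,Q_{n+\mu-1/2}^{\nu-\mu-1/2}(z)\,C_n^\mu(x),$$ where the series converges absolutely and $(z-x)^\nu$ denotes the branch that is holomorphic in $x$ in the interior of the ellipse and principal for $x\in[-1,1]$, i.e. $(z-x)^\nu=z^\nu(1-x/z)^\nu$ with principal powers on the right. (ii) Let $\nu\in\mathbb C\setminus(-\mathbb N_0)$, $\rho\in\mathbb C\setminus(-\infty,0]$ with $|\rho|<1$, and $x\in[-1,1]$. Then $$\frac1{(1+\rho^2-2\rho x)^\nu}=\frac{\Gamma(\mu)\,e^{i\pi(\mu-\nu+1/2)}}{\sqrt\pi\,\Gamma(\nu)\,\rho^{\mu+1/2}(1-\rho^2)^{\nu-\mu-1/2}}\sum_{n=0}^\infty(n+\mu)\,Q_{n+\mu-1/2}^{\nu-\mu-1/2}\Big(\frac{1+\rho^2}{2\rho}\Big)C_n^\mu(x),$$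 with an absolutely convergent series. (iii) If $\nu=\mu$ then, for each $n$, the $n$-th term of the right-hand side in (ii), including the factor in front of the sum, equals $C_n^\mu(x)\rho^n$. Thus (ii) reduces to the generating function of the Gegenbauer polynomials, $$\frac1{(1+\rho^2-2\rho x)^\mu}=\sum_{n=0}^\infty C_n^\mu(x)\,\rho^n ,$$ which holds (with absolute convergence) for all $\rho\in\mathbb C$ with $|\rho|<1$ and all $x\in[-1,1]$. -/

import Mathlib

noncomputable section

open Complex

/-- The plane cut along the real half-line from `-∞` to `1` (end point removed as well). -/
def cutPlane : Set ℂ := {z | 1 < z.re ∨ z.im ≠ 0}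

/-- The ellipse with foci `1` and `-1` on which the sum of the distances to the foci is `R`
(a genuine, non-degenerate ellipse when `2 < R`). -/
def focalEllipse (R : ℝ) : Set ℂ := {w | ‖w - 1‖ + ‖w + 1‖ = R}

/-- The open region bounded by `focalEllipse R`. -/
def focalEllipseInterior (R : ℝ) : Set ℂ := {w | ‖w - 1‖ + ‖w + 1‖ < R}

/-- The Gegenbauer polynomial of degree `n` and order `μ`:
`C_n^μ(x) = (2μ)_n / n! * ₂F₁(-n, n + 2μ; μ + 1/2; (1 - x)/2)`, a terminating series. -/
def gegenbauerC (n : ℕ) (μ x : ℂ) : ℂ :=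
  (∏ i ∈ Finset.range n, (2 * μ + i)) / (n.factorial : ℂ) *
    ordinaryHypergeometric (-(n : ℂ)) (n + 2 * μ) (μ + 1 / 2) ((1 - x) / 2)

/-- The branch of `(z ^ 2 - 1) ^ a` that is holomorphic on the cut plane and principal
for real `z > 1`. -/
def sqSubOnePow (z a : ℂ) : ℂ := (z - 1) ^ a * (z + 1) ^ a

/-- The hypergeometric expression for the associated Legendre function of the second kind of
degree `ν` and order `μ`, meaningful for `1 < ‖z‖`, `z` in the cut plane. -/
def legendreQSeries (ν μ z : ℂ) : ℂ :=
  (Real.sqrt Real.pi : ℂ) * exp (I * Real.pi * μ) * Gamma (ν + μ + 1) * sqSubOnePow z (μ / 2) /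
      ((2 : ℂ) ^ (ν + 1) * Gamma (ν + 3 / 2) * z ^ (ν + μ + 1)) *
    ordinaryHypergeometric ((ν + μ + 2) / 2) ((ν + μ + 1) / 2) (ν + 3 / 2) (1 / z ^ 2)

/-- `f` is, on the cut plane, the analytic continuation of the hypergeometric expression. -/
def IsLegendreQ (ν μ : ℂ) (f : ℂ → ℂ) : Prop :=
  DifferentiableOn ℂ f cutPlane ∧ ∀ z ∈ cutPlane, 1 < ‖z‖ → f z = legendreQSeries ν μ z

open Classical in
/-- The associated Legendre function of the second kind `Q_ν^μ` on the cut plane: the analytic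
continuation to the whole cut plane of the hypergeometric expression valid for `1 < ‖z‖`. -/
def legendreQ (ν μ : ℂ) : ℂ → ℂ :=
  if h : ∃ f, IsLegendreQ ν μ f then h.choose else 0

/-- The power `(z - x) ^ ν`, as the branch that is holomorphic in `x` inside the ellipse with foci
`1` and `-1` through `z` and that is the principal value for `x` in `[-1, 1]`
(see the two lemmas below). -/
def subPow (z x ν : ℂ) : ℂ := z ^ ν * (1 - x / z) ^ ν

theorem cutPlane_ne_zero {z : ℂ} (hz : z ∈ cutPlane) : z ≠ 0 := by
  rintro rfl
  rcases hz with h | h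
  · norm_num at h
  · exact h rfl

/-- The continuation is unique, so `legendreQ` does not depend on a choice. -/
theorem legendreQ_eq_of_isLegendreQ {ν μ : ℂ} {f : ℂ → ℂ} (hf : IsLegendreQ ν μ f) :
    Set.EqOn (legendreQ ν μ) f cutPlane := by
  have hex : ∃ f, IsLegendreQ ν μ f := ⟨f, hf⟩
  have hQ : IsLegendreQ ν μ (legendreQ ν μ) := by
    unfold legendreQ
    rw [dif_pos hex]
    exact hex.choose_spec
  have hopen : IsOpen cutPlane :=
    (isOpen_lt continuous_const continuous_re).union (isOpen_ne_fun continuous_im continuous_const)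
  have hstar : StarConvex ℝ (2 : ℂ) cutPlane := by
    intro z hz a b ha hb hab
    have him : (a • (2 : ℂ) + b • z).im = b * z.im := by simp
    have hre : (a • (2 : ℂ) + b • z).re = a * 2 + b * z.re := by simp
    show 1 < (a • (2 : ℂ) + b • z).re ∨ (a • (2 : ℂ) + b • z).im ≠ 0
    rw [him, hre]
    rcases hb.eq_or_lt with h0 | h0
    · left
      subst h0
      linarith
    · rcases hz with h | h
      · left
        nlinarith
      · right
        exact mul_ne_zero h0.ne' h
  have h3 : (3 : ℂ) ∈ cutPlane := Or.inl (by norm_num)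
  have hev : legendreQ ν μ =ᶠ[nhds 3] f := by
    have h1 : cutPlane ∩ {z : ℂ | 1 < ‖z‖} ∈ nhds (3 : ℂ) :=
      (hopen.inter (isOpen_lt continuous_const continuous_norm)).mem_nhds
        ⟨h3, by show (1 : ℝ) < ‖(3 : ℂ)‖; norm_num⟩
    filter_upwards [h1] with z hz
    rw [hQ.2 z hz.1 hz.2, hf.2 z hz.1 hz.2]
  exact (hQ.1.analyticOnNhd hopen).eqOn_of_preconnected_of_eventuallyEq
    (hf.1.analyticOnNhd hopen) (StarConvex.isPathConnected (a := (2 : ℂ)) hstar (Or.inl (by norm_num))).isConnected.isPreconnected h3 hev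

/-- The ellipse is symmetric and convex, so `1 - x / z` avoids the cut of the principal power. -/
theorem one_sub_div_mem_slitPlane {R : ℝ} {z x : ℂ} (hz : z ∈ cutPlane)
    (hzR : z ∈ focalEllipse R) (hx : x ∈ focalEllipseInterior R) : 1 - x / z ∈ slitPlane := by
  by_contra hcon
  have hz0 := cutPlane_ne_zero hz
  rw [mem_slitPlane_iff, not_or, not_lt, not_not] at hcon
  obtain ⟨hre, him⟩ := hcon
  set t : ℝ := (x / z).re with ht
  have hxt : x / z = (t : ℂ) := by
    apply Complex.ext
    · simp [ht]
    · simpa using him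
  have ht1 : 1 ≤ t := by
    simpa using hre
  have hx' : x = t * z := by
    rw [← hxt]
    field_simp
  have ht0 : 0 < t := by linarith
  -- write `z` as a convex combination of `t z` and `-t z`
  have h2 : ‖z - 1‖ + ‖z + 1‖ ≤ ‖(t : ℂ) * z - 1‖ + ‖(t : ℂ) * z + 1‖ := by
    have e1 : z - 1 = (((1 + t⁻¹) / 2 : ℝ) : ℂ) * (t * z - 1)
        - (((1 - t⁻¹) / 2 : ℝ) : ℂ) * (t * z + 1) := by
      push_cast
      have : (t : ℂ) ≠ 0 := by exact_mod_cast ht0.ne'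
      field_simp
      ring
    have e2 : z + 1 = (((1 + t⁻¹) / 2 : ℝ) : ℂ) * (t * z + 1)
        - (((1 - t⁻¹) / 2 : ℝ) : ℂ) * (t * z - 1) := by
      push_cast
      have : (t : ℂ) ≠ 0 := by exact_mod_cast ht0.ne'
      field_simp
      ring
    have hinv : t⁻¹ ≤ 1 := inv_le_one_of_one_le₀ ht1
    have hinv0 : 0 < t⁻¹ := inv_pos.mpr ht0
    have n1 : ‖z - 1‖ ≤ (1 + t⁻¹) / 2 * ‖(t : ℂ) * z - 1‖ + (1 - t⁻¹) / 2 * ‖(t : ℂ) * z + 1‖ := by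
      rw [e1]
      refine (norm_sub_le _ _).trans (le_of_eq ?_)
      rw [norm_mul, norm_mul, norm_real, norm_real, Real.norm_of_nonneg (by linarith),
        Real.norm_of_nonneg (by linarith)]
    have n2 : ‖z + 1‖ ≤ (1 + t⁻¹) / 2 * ‖(t : ℂ) * z + 1‖ + (1 - t⁻¹) / 2 * ‖(t : ℂ) * z - 1‖ := by
      rw [e2]
      refine (norm_sub_le _ _).trans (le_of_eq ?_)
      rw [norm_mul, norm_mul, norm_real, norm_real, Real.norm_of_nonneg (by linarith),
        Real.norm_of_nonneg (by linarith)]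
    linarith
  have hx2 : ‖x - 1‖ + ‖x + 1‖ < R := hx
  have hz2 : ‖z - 1‖ + ‖z + 1‖ = R := hzR
  rw [hx'] at hx2
  linarith

/-- `subPow` is holomorphic in `x` inside the ellipse through `z`. -/
theorem differentiableOn_subPow {R : ℝ} {z : ℂ} (ν : ℂ) (hz : z ∈ cutPlane)
    (hzR : z ∈ focalEllipse R) :
    DifferentiableOn ℂ (fun x => subPow z x ν) (focalEllipseInterior R) := by
  intro x hx
  have h := one_sub_div_mem_slitPlane hz hzR hx
  refine DifferentiableAt.differentiableWithinAt ?_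
  unfold subPow
  refine DifferentiableAt.const_mul ?_ _
  exact DifferentiableAt.cpow (by fun_prop) (by fun_prop) h

/-- `subPow` is the principal power for `x` in `[-1, 1]`. -/
theorem subPow_eq_cpow {z : ℂ} (ν : ℂ) (hz : z ∈ cutPlane) {x : ℝ} (hx : x ∈ Set.Icc (-1 : ℝ) 1) :
    subPow z x ν = (z - x) ^ ν := by
  have hz0 := cutPlane_ne_zero hz
  have hzx : z - x ≠ 0 := by
    intro h
    have hzx' : z = x := sub_eq_zero.mp h
    rw [hzx'] at hz
    rcases hz with h1 | h1
    · rw [ofReal_re] at h1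
      linarith [hx.2]
    · exact h1 (ofReal_im x)
  have him : (z - x).im = z.im := by simp
  have hre : (z - x).re = z.re - x := by simp
  have hu : 1 - x / z = exp (log (z - x) - log z) := by
    rw [exp_sub, exp_log hzx, exp_log hz0]
    field_simp
  have hdiff : -Real.pi < arg (z - x) - arg z ∧ arg (z - x) - arg z < Real.pi := by
    have hpi := Real.pi_pos
    rcases lt_trichotomy z.im 0 with h | h | h
    · have a1 := arg_neg_iff.mpr h
      have a2 := arg_neg_iff.mpr (him ▸ h)
      have a3 := neg_pi_lt_arg z
      have a4 := neg_pi_lt_arg (z - x)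
      constructor <;> linarith
    · have hr : 1 < z.re := hz.resolve_right (fun h' => h' h)
      have a1 : arg z = 0 := arg_eq_zero_iff.mpr ⟨by linarith, h⟩
      have a2 : arg (z - x) = 0 :=
        arg_eq_zero_iff.mpr ⟨by rw [hre]; linarith [hx.2], by rw [him, h]⟩
      rw [a1, a2]
      constructor <;> linarith
    · have a1 : 0 ≤ arg z := arg_nonneg_iff.mpr h.le
      have a2 : 0 ≤ arg (z - x) := arg_nonneg_iff.mpr (by rw [him]; exact h.le)
      have a3 : arg z < Real.pi :=
        lt_of_le_of_ne (arg_le_pi z) (fun h' => h.ne' (arg_eq_pi_iff.mp h').2)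
      have a4 : arg (z - x) < Real.pi :=
        lt_of_le_of_ne (arg_le_pi _) (fun h' => by
          have := (arg_eq_pi_iff.mp h').2
          rw [him] at this
          exact h.ne' this)
      constructor
      · have a5 : 0 < arg z ∨ arg z = 0 := a1.lt_or_eq.imp id Eq.symm
        linarith
      · linarith
  have hlog : log (1 - x / z) = log (z - x) - log z := by
    rw [hu, log_exp]
    · rw [sub_im, log_im, log_im]
      exact hdiff.1
    · rw [sub_im, log_im, log_im]
      exact hdiff.2.le
  have hu0 : 1 - x / z ≠ 0 := by
    rw [hu]
    exact exp_ne_zero _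
  unfold subPow
  rw [cpow_def_of_ne_zero hz0, cpow_def_of_ne_zero hu0, cpow_def_of_ne_zero hzx, hlog, ← exp_add]
  congr 1
  ring

end

noncomputable section

open Complex

/-! Write `z = (ρ + ρ⁻¹) / 2` and `x = (w + w⁻¹) / 2` with `‖ρ‖ < 1` and `‖w‖ ≤ 1`. Then `1 + ρ² -
2ρx = (1 - ρw)(1 - ρ/w)`, and if `x` is inside the ellipse through `z`, then `‖ρ‖ < ‖w‖`. So both
factors have convergent binomial series, and their Cauchy product expands the `-ν`-th power in `ρ`,
with the order-`ν` Gegenbauer polynomials in Laurent form as coefficients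
(`hasSum_gegenbauerLaurent`).

The connection formula (`gegenbauerLaurent_connection`) writes the polynomial of order `ν` and
degree `m` through those of order `μ` and degrees `m - 2k`. The double series converges absolutely
(`summable_connection`). Collecting the terms with `n = m - 2k` fixed leaves `ρ ^ n` times a
hypergeometric series in `ρ²` with parameters `n + ν`, `ν - μ`, `n + μ + 1`.

That series is the Legendre function at `z`: a quadratic transformation gives this for small `ρ`
(`legendreQSeries_joukowski`), and the identity theorem gives it on the whole cut plane
(`legendreQ_joukowski`). The rest is the bookkeeping of branches: on the slit disc `z` and `ρ` lie
in opposite half-planes, so the logarithms that occur are additive. -/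

/-! ### Rising factorials. -/

/-- The rising factorial `a (a + 1) ⋯ (a + n - 1)`. -/
def risingFactorial (a : ℂ) (n : ℕ) : ℂ := ∏ i ∈ Finset.range n, (a + i)

theorem risingFactorial_zero (a : ℂ) : risingFactorial a 0 = 1 := by
  simp [risingFactorial]

theorem risingFactorial_succ (a : ℂ) (n : ℕ) :
    risingFactorial a (n + 1) = risingFactorial a n * (a + n) := by
  simp [risingFactorial, Finset.prod_range_succ]

theorem risingFactorial_add (a : ℂ) (m n : ℕ) :
    risingFactorial a (m + n) = risingFactorial a m * risingFactorial (a + m) n := by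
  induction n with
  | zero => simp [risingFactorial_zero]
  | succ n ih =>
    rw [← add_assoc, risingFactorial_succ, ih, risingFactorial_succ]
    push_cast
    ring

theorem risingFactorial_succ' (a : ℂ) (n : ℕ) :
    risingFactorial a (n + 1) = a * risingFactorial (a + 1) n := by
  rw [add_comm, risingFactorial_add]
  simp [risingFactorial]

theorem risingFactorial_one (n : ℕ) : risingFactorial 1 n = n.factorial := by
  induction n with
  | zero => simp [risingFactorial_zero]
  | succ n ih =>
    rw [risingFactorial_succ, ih, Nat.factorial_succ]
    push_cast
    ring

theorem risingFactorial_ne_zero {a : ℂ} (ha : ∀ k : ℕ, a + k ≠ 0) (n : ℕ) :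
    risingFactorial a n ≠ 0 :=
  Finset.prod_ne_zero_iff.mpr fun k _ => ha k

theorem ascPochhammer_eval_eq_risingFactorial (a : ℂ) (n : ℕ) :
    (ascPochhammer ℂ n).eval a = risingFactorial a n := by
  induction n with
  | zero => simp [risingFactorial_zero]
  | succ n ih => rw [ascPochhammer_succ_eval, ih, risingFactorial_succ]

theorem Gamma_add_nat_eq_risingFactorial_mul {a : ℂ} (ha : ∀ k : ℕ, a + k ≠ 0) (n : ℕ) :
    Gamma (a + n) = risingFactorial a n * Gamma a := by
  induction n with
  | zero => simp [risingFactorial_zero]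
  | succ n ih =>
    rw [risingFactorial_succ, Nat.cast_succ, ← add_assoc, Gamma_add_one _ (ha n), ih]
    ring

/-! ### Subexponential growth, the source of all convergence statements. -/

/-- Sequences growing more slowly than every geometric sequence of ratio larger than one. -/
def Subexponential (u : ℕ → ℂ) : Prop :=
  ∀ s : ℝ, 1 < s → ∃ K : ℝ, 0 < K ∧ ∀ n, ‖u n‖ ≤ K * s ^ n

/-- Each factor is bounded at the rate `√s`, so that the product grows at the rate `s`. -/
theorem Subexponential.mul {u v : ℕ → ℂ} (hu : Subexponential u) (hv : Subexponential v) :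
    Subexponential fun n => u n * v n := by
  intro s hs
  have hs' : 1 < √s := by
    rw [Real.lt_sqrt (by norm_num)]
    simpa using hs
  obtain ⟨K, hK, h1⟩ := hu _ hs'
  obtain ⟨M, hM, h2⟩ := hv _ hs'
  refine ⟨K * M, by positivity, fun n => ?_⟩
  calc ‖u n * v n‖ ≤ (K * √s ^ n) * (M * √s ^ n) := by
        rw [norm_mul]
        gcongr
        · exact h1 n
        · exact h2 n
    _ = K * M * (√s ^ 2) ^ n := by ring
    _ = K * M * s ^ n := by rw [Real.sq_sqrt (by linarith)]

/-- By the ratio test `u n / s ^ n` is summable, hence bounded. -/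
theorem subexponential_of_ratio {u q : ℕ → ℂ} (hu : ∀ n, u (n + 1) = u n * q n)
    (hq : Filter.Tendsto q Filter.atTop (nhds 1)) : Subexponential u := by
  intro s hs
  have hs0 : 0 < s := by linarith
  have hev : ∀ᶠ n in Filter.atTop, ‖q n‖ < (1 + s) / 2 := by
    have := hq.norm
    rw [norm_one] at this
    exact this.eventually_lt_const (by linarith)
  have hsum : Summable fun n => u n * ((s : ℂ)⁻¹) ^ n := by
    refine summable_of_ratio_norm_eventually_le (r := (1 + s) / 2 / s)
      (by rw [div_lt_one hs0]; linarith) ?_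
    filter_upwards [hev] with n hn
    rw [hu, norm_mul, norm_mul, norm_mul, norm_pow, norm_pow, norm_inv, norm_real,
      Real.norm_of_nonneg hs0.le, pow_succ]
    calc ‖u n‖ * ‖q n‖ * (s⁻¹ ^ n * s⁻¹) = ‖q n‖ * (‖u n‖ * s⁻¹ ^ n * s⁻¹) := by ring
      _ ≤ (1 + s) / 2 * (‖u n‖ * s⁻¹ ^ n * s⁻¹) := by gcongr
      _ = _ := by ring
  obtain ⟨K, hK⟩ := (Metric.isBounded_range_of_tendsto _ hsum.tendsto_atTop_zero).exists_norm_le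
  refine ⟨max K 1, by positivity, fun n => ?_⟩
  have h := hK _ ⟨n, rfl⟩
  rw [norm_mul, norm_pow, norm_inv, norm_real, Real.norm_of_nonneg hs0.le, inv_pow,
    ← div_eq_mul_inv, div_le_iff₀ (by positivity)] at h
  exact h.trans (by gcongr; exact le_max_left _ _)

/-- If `c + n = 0` for some `n`, division by zero makes all later terms zero, which is compatible
with the ratio recursion. Hence `c` can be arbitrary. -/
theorem subexponential_risingFactorial_div (a c : ℂ) :
    Subexponential fun n => risingFactorial a n / risingFactorial c n := by
  refine subexponential_of_ratio (q := fun n => (a + n) / (c + n)) (fun n => ?_) ?_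
  · rw [risingFactorial_succ, risingFactorial_succ, mul_div_mul_comm]
  · simpa using tendsto_add_mul_div_add_mul_atTop_nhds a c (1 : ℂ) one_ne_zero

theorem subexponential_risingFactorial_div_factorial (a : ℂ) :
    Subexponential fun n => risingFactorial a n / n.factorial := by
  simpa only [risingFactorial_one] using
    subexponential_risingFactorial_div a 1

theorem subexponential_factorial_div (c : ℂ) :
    Subexponential fun n => n.factorial / risingFactorial c n := by
  simpa only [risingFactorial_one] using subexponential_risingFactorial_div 1 c

theorem exists_one_lt_mul_lt {r R : ℝ} (h0 : 0 ≤ r) (h : r < R) : ∃ s : ℝ, 1 < s ∧ s * r < R := by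
  rcases h0.eq_or_lt with rfl | h0
  · exact ⟨2, by norm_num, by simpa using h⟩
  · obtain ⟨s, h1, h2⟩ := exists_between ((one_lt_div h0).mpr h)
    exact ⟨s, h1, (lt_div_iff₀ h0).mp h2⟩

theorem Subexponential.summable_norm {u : ℕ → ℂ} (hu : Subexponential u) {y : ℂ} (hy : ‖y‖ < 1) :
    Summable fun n => ‖u n * y ^ n‖ := by
  obtain ⟨s, hs, hsy⟩ := exists_one_lt_mul_lt (norm_nonneg y) hy
  obtain ⟨K, hK, h⟩ := hu s hs
  refine Summable.of_nonneg_of_le (fun n => norm_nonneg _) (fun n => ?_)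
    ((summable_geometric_of_lt_one (by positivity) hsy).mul_left K)
  rw [norm_mul, norm_pow, mul_pow, ← mul_assoc]
  gcongr
  exact h n

/-! ### Binomial and hypergeometric series in the unit disc. -/

/-- The sign of `-t` turns the generalized binomial coefficient of `-ν` into a rising factorial of
`ν`. -/
theorem hasSum_binomial (ν : ℂ) {t : ℂ} (ht : ‖t‖ < 1) :
    HasSum (fun n => risingFactorial ν n / n.factorial * t ^ n) ((1 - t) ^ (-ν)) := by
  have h := (one_add_cpow_hasFPowerSeriesOnBall_zero (a := -ν)).hasSum (y := -t)
    (by simpa [← ENNReal.ofReal_one, Metric.eball_ofReal] using ht)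
  simp only [zero_add, binomialSeries_apply, List.ofFn_const, List.prod_replicate, smul_eq_mul] at h
  rw [← sub_eq_add_neg] at h
  convert! h using 2 with n
  rw [Ring.choose_eq_smul, Polynomial.descPochhammer_smeval_eq_ascPochhammer,
    Polynomial.ascPochhammer_smeval_cast, Polynomial.ascPochhammer_smeval_eq_eval,
    ← descPochhammer_eval_eq_ascPochhammer, ← neg_one_mul t, mul_pow,
    ← ascPochhammer_eval_eq_risingFactorial, ← neg_neg ν, ascPochhammer_eval_neg_eq_descPochhammer,
    neg_neg, Algebra.smul_def, map_inv₀, map_natCast]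
  have : ((-1 : ℂ)) ^ n * (-1) ^ n = 1 := by rw [← mul_pow]; simp
  field_simp

/-- The coefficients of the Gauss hypergeometric series. -/
def hypergeometricTerm (a b c : ℂ) (n : ℕ) : ℂ :=
  risingFactorial a n * risingFactorial b n / (risingFactorial c n * n.factorial)

theorem subexponential_hypergeometricTerm (a b c : ℂ) :
    Subexponential (hypergeometricTerm a b c) := by
  have h := (subexponential_risingFactorial_div a c).mul
    (subexponential_risingFactorial_div_factorial b)
  convert! h using 2 with n
  rw [hypergeometricTerm, mul_div_mul_comm]

theorem ordinaryHypergeometricCoefficient_eq (a b c : ℂ) (n : ℕ) :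
    ordinaryHypergeometricCoefficient a b c n = hypergeometricTerm a b c n := by
  simp only [ordinaryHypergeometricCoefficient, ascPochhammer_eval_eq_risingFactorial,
    hypergeometricTerm]
  rw [div_eq_mul_inv, mul_inv]
  ring

theorem ordinaryHypergeometric_eq_tsum_hypergeometricTerm (a b c y : ℂ) :
    ordinaryHypergeometric a b c y = ∑' n, hypergeometricTerm a b c n * y ^ n := by
  rw [ordinaryHypergeometric_eq_tsum]
  exact tsum_congr fun n => by rw [smul_eq_mul, ← ordinaryHypergeometricCoefficient_eq]

theorem hasSum_ordinaryHypergeometric (a b c : ℂ) {y : ℂ}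
    (hy : ‖y‖ < 1) :
    HasSum (fun n => hypergeometricTerm a b c n * y ^ n) (ordinaryHypergeometric a b c y) := by
  rw [ordinaryHypergeometric_eq_tsum_hypergeometricTerm]
  exact ((subexponential_hypergeometricTerm a b c).summable_norm hy).of_norm.hasSum

theorem differentiableOn_ordinaryHypergeometric (a b c : ℂ) :
    DifferentiableOn ℂ (ordinaryHypergeometric a b c : ℂ → ℂ) (Metric.ball 0 1) := by
  have hrad : 1 ≤ (ordinaryHypergeometricSeries ℂ a b c).radius := by
    refine ENNReal.le_of_forall_nnreal_lt fun r hr => ?_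
    refine FormalMultilinearSeries.le_radius_of_summable_norm _ ?_
    have hr' : ‖((r : ℝ) : ℂ)‖ < 1 := by
      rw [norm_real, Real.norm_of_nonneg r.coe_nonneg]
      exact_mod_cast hr
    refine ((subexponential_hypergeometricTerm a b c).summable_norm hr').congr fun n => ?_
    rw [ordinaryHypergeometricSeries, FormalMultilinearSeries.ofScalars_norm,
      ordinaryHypergeometricCoefficient_eq, norm_mul, norm_pow, norm_real,
      Real.norm_of_nonneg r.coe_nonneg]
  have h := (FormalMultilinearSeries.hasFPowerSeriesOnBall _
    (zero_lt_one.trans_le hrad)).mono zero_lt_one hrad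
  have := h.differentiableOn
  rwa [← ENNReal.ofReal_one, Metric.eball_ofReal] at this

/-! ### Chu–Vandermonde and the quadratic transformation. -/

/-- The Chu–Vandermonde identity. -/
theorem sum_choose_mul_risingFactorial_div (m : ℕ) {B c : ℂ} (hc : ∀ k : ℕ, c + k ≠ 0) :
    ∑ p ∈ Finset.HasAntidiagonal.antidiagonal m,
      (m.choose p.1 : ℂ) * ((-1) ^ p.1 * (risingFactorial B p.1 / risingFactorial c p.1)) =
      risingFactorial (c - B) m / risingFactorial c m := by
  induction m generalizing B c with
  | zero => simp [risingFactorial_zero]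
  | succ m ih =>
    have hc' : ∀ k : ℕ, c + 1 + k ≠ 0 := fun k => by
      have := hc (k + 1)
      push_cast at this
      rwa [add_assoc, add_comm (1 : ℂ)]
    have h1 := ih (B := B) hc
    -- Pascal's rule produces two sums. The one with shifted index is the case `B + 1`, `c + 1`,
    -- where `c - B` is unchanged; this is why the induction runs over all `B` and `c`.
    have h2 := ih (B := B + 1) hc'
    rw [Finset.sum_antidiagonal_choose_succ_mul
      (fun i _ => (-1) ^ i * (risingFactorial B i / risingFactorial c i)), h1]
    have h3 : ∑ p ∈ Finset.HasAntidiagonal.antidiagonal m, (m.choose p.2 : ℂ) *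
        ((-1) ^ (p.1 + 1) * (risingFactorial B (p.1 + 1) / risingFactorial c (p.1 + 1))) =
        -(B / c) * (risingFactorial (c - B) m / risingFactorial (c + 1) m) := by
      rw [show c - B = c + 1 - (B + 1) by ring, ← h2, Finset.mul_sum]
      refine Finset.sum_congr rfl fun p hp => ?_
      rw [← Nat.choose_symm_of_eq_add (Finset.HasAntidiagonal.mem_antidiagonal.mp hp).symm,
        risingFactorial_succ', risingFactorial_succ', pow_succ, mul_div_mul_comm]
      ring
    have hc0 : c ≠ 0 := by simpa using hc 0
    have hcm := hc m
    have e1 := risingFactorial_succ c m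
    have e2 := risingFactorial_succ' c m
    have n1 := risingFactorial_ne_zero hc m
    have n2 := risingFactorial_ne_zero hc' m
    rw [h3, e1, risingFactorial_succ]
    have e3 : risingFactorial (c + 1) m = risingFactorial c m * (c + m) / c := by
      rw [← e1, e2]
      field_simp
    rw [e3]
    field_simp
    ring

theorem risingFactorial_two_mul (A : ℂ) (k : ℕ) :
    risingFactorial A (2 * k) =
      4 ^ k * risingFactorial ((A + 1) / 2) k * risingFactorial (A / 2) k := by
  induction k with
  | zero => simp [risingFactorial_zero]
  | succ k ih =>
    rw [show 2 * (k + 1) = 2 * k + 1 + 1 by ring, risingFactorial_succ, risingFactorial_succ, ih,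
      risingFactorial_succ, risingFactorial_succ]
    push_cast
    ring

/-- The trinomial coefficient is a product of two binomial coefficients, each at most a power of
two. -/
theorem factorial_two_mul_add_le (k j : ℕ) :
    ((2 * k + j).factorial : ℝ) ≤
      2 ^ (2 * k + j) * 4 ^ k * (k.factorial * k.factorial * j.factorial) := by
  have h1 : (2 * k + j).choose j * j.factorial * (2 * k).factorial = (2 * k + j).factorial := by
    have := Nat.choose_mul_factorial_mul_factorial (Nat.le_add_left j (2 * k))
    rwa [Nat.add_sub_cancel] at this
  have h2 : k.centralBinom * k.factorial * k.factorial = (2 * k).factorial := by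
    have := Nat.choose_mul_factorial_mul_factorial (Nat.le_mul_of_pos_left k two_pos)
    rwa [show 2 * k - k = k by omega] at this
  have h3 : (2 * k + j).choose j ≤ 2 ^ (2 * k + j) := Nat.choose_le_two_pow _ _
  have h4 : k.centralBinom ≤ 4 ^ k := by
    have : k.centralBinom ≤ 2 ^ (2 * k) := Nat.choose_le_two_pow _ _
    rwa [pow_mul] at this
  rw [← h1, ← h2]
  push_cast
  have h3' : ((2 * k + j).choose j : ℝ) ≤ 2 ^ (2 * k + j) := by exact_mod_cast h3
  have h4' : (k.centralBinom : ℝ) ≤ 4 ^ k := by exact_mod_cast h4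
  calc _ = ((2 * k + j).choose j : ℝ) * k.centralBinom *
        (k.factorial * k.factorial * j.factorial) := by ring
    _ ≤ _ := by gcongr

/-- Taking growth rate `2` everywhere, the terms are dominated by a double geometric series of ratio
`2 ^ 7 * ‖y‖`, which is below one for `‖y‖ < 1 / 200`. Any neighbourhood of the origin suffices,
since the result is continued analytically later. -/
theorem summable_quadratic_transformation (A c : ℂ) {y : ℂ} (hy : ‖y‖ < 1 / 200) :
    Summable fun p : ℕ × ℕ => risingFactorial A (2 * p.1 + p.2) /
      (risingFactorial c p.1 * p.1.factorial * p.2.factorial) * (-1) ^ p.2 * y ^ (p.1 + p.2) := by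
  obtain ⟨K, hK, h1⟩ := subexponential_risingFactorial_div_factorial A 2 one_lt_two
  obtain ⟨M, hM, h2⟩ := subexponential_factorial_div c 2 one_lt_two
  have hg : Summable fun p : ℕ × ℕ => K * M * ((128 * ‖y‖) ^ p.1 * (128 * ‖y‖) ^ p.2) := by
    refine Summable.mul_left _ ?_
    have := summable_geometric_of_lt_one (r := 128 * ‖y‖) (by positivity) (by linarith)
    exact this.mul_of_nonneg this (fun _ => by positivity) (fun _ => by positivity)
  refine Summable.of_norm_bounded hg fun ⟨k, j⟩ => ?_
  have e : risingFactorial A (2 * k + j) / (risingFactorial c k * k.factorial * j.factorial) =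
      (risingFactorial A (2 * k + j) / (2 * k + j).factorial) *
      ((k.factorial / risingFactorial c k) *
      (((2 * k + j).factorial / (k.factorial * k.factorial * j.factorial) : ℝ) : ℂ)) := by
    have := Nat.factorial_ne_zero k
    have := Nat.factorial_ne_zero j
    have := Nat.factorial_ne_zero (2 * k + j)
    push_cast
    rw [div_mul_div_comm, div_mul_div_comm, div_eq_div_iff_comm, ← div_eq_div_iff_comm]
    by_cases hc : risingFactorial c k = 0
    · simp [hc]
    · field_simp
  have h3 : ((2 * k + j).factorial / (k.factorial * k.factorial * j.factorial) : ℝ) ≤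
      2 ^ (2 * k + j) * 4 ^ k := by
    rw [div_le_iff₀ (by positivity)]
    exact factorial_two_mul_add_le k j
  have h0 : (0 : ℝ) ≤ (2 * k + j).factorial / (k.factorial * k.factorial * j.factorial) := by
    positivity
  simp only [e]
  rw [norm_mul, norm_mul, norm_mul, norm_mul, norm_real, Real.norm_of_nonneg h0, norm_pow,
    norm_pow, norm_neg, norm_one, one_pow, mul_one]
  calc _ ≤ K * 2 ^ (2 * k + j) * ((M * 2 ^ k) * (2 ^ (2 * k + j) * 4 ^ k)) * ‖y‖ ^ (k + j) := by
        gcongr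
        · exact h1 _
        · exact h2 _
    _ = K * M * (2 ^ (2 * k + j) * 2 ^ (2 * k + j) * 2 ^ k * (2 ^ 2) ^ k) * ‖y‖ ^ (k + j) := by
        rw [show (4 : ℝ) = 2 ^ 2 by norm_num]
        ring
    _ = K * M * (2 ^ (7 * k + 2 * j)) * ‖y‖ ^ (k + j) := by
        rw [← pow_mul, ← pow_add, ← pow_add, ← pow_add]; congr 3; ring
    _ ≤ K * M * (2 ^ (7 * k + 7 * j)) * ‖y‖ ^ (k + j) := by
        gcongr
        · norm_num
        · norm_num
    _ = K * M * ((128 * ‖y‖) ^ k * (128 * ‖y‖) ^ j) := by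
        rw [← pow_add, mul_pow, ← mul_add, pow_mul, show (2 : ℝ) ^ 7 = 128 by norm_num]
        ring

theorem HasSum.sum_antidiagonal {f : ℕ × ℕ → ℂ} {S : ℂ} (h : HasSum f S) :
    HasSum (fun m => ∑ p ∈ Finset.HasAntidiagonal.antidiagonal m, f p) S := by
  rw [← Finset.HasAntidiagonal.sigmaAntidiagonalEquivProd.hasSum_iff] at h
  refine h.sigma fun m => ?_
  have := Finset.hasSum (Finset.HasAntidiagonal.antidiagonal m) f
  exact this

/-- A quadratic transformation of the Gauss hypergeometric function, near the origin. -/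
theorem ordinaryHypergeometric_quadratic (A : ℂ) {c y : ℂ} (hc : ∀ k : ℕ, c + k ≠ 0)
    (hy : ‖y‖ < 1 / 200) :
    ordinaryHypergeometric ((A + 1) / 2) (A / 2) c (4 * y / (1 + y) ^ 2) =
      (1 + y) ^ A * ordinaryHypergeometric A (A - c + 1) c y := by
  have hy1 : ‖-y‖ < 1 := by rw [norm_neg]; linarith
  have hy0 : 1 + y ≠ 0 := by
    intro h
    have : y = -1 := by linear_combination h
    rw [this] at hy
    norm_num at hy
  have hT := (summable_quadratic_transformation A c hy).hasSum
  set S := ∑' p : ℕ × ℕ, risingFactorial A (2 * p.1 + p.2) /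
      (risingFactorial c p.1 * p.1.factorial * p.2.factorial) * (-1) ^ p.2 * y ^ (p.1 + p.2)
  -- The double series is summed in two ways. For fixed `k`, the sum over `j` is the binomial series
  -- of `(1 + y) ^ (-A - 2 * k)`.
  have hleft := hT.prod_fiberwise (g := fun k => (1 + y) ^ (-A) *
      (hypergeometricTerm ((A + 1) / 2) (A / 2) c k * (4 * y / (1 + y) ^ 2) ^ k)) (fun k => by
    have h := (hasSum_binomial (A + (2 * k : ℕ)) hy1).mul_left
      (risingFactorial A (2 * k) / (risingFactorial c k * k.factorial) * y ^ k)
    convert! h using 1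
    · ext j
      simp only [risingFactorial_add, neg_pow y, pow_add]
      have := risingFactorial_ne_zero hc k
      have := Nat.factorial_ne_zero k
      have := Nat.factorial_ne_zero j
      field_simp
    · rw [sub_neg_eq_add, neg_add, cpow_add _ _ hy0, cpow_neg _ ((2 * k : ℕ) : ℂ), cpow_natCast,
        risingFactorial_two_mul, hypergeometricTerm, div_pow, mul_pow, ← pow_mul]
      have := risingFactorial_ne_zero hc k
      have := Nat.factorial_ne_zero k
      field_simp)
  have hright := hT.sum_antidiagonal
  have e : ∀ m, ∑ p ∈ Finset.HasAntidiagonal.antidiagonal m, risingFactorial A (2 * p.1 + p.2) /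
      (risingFactorial c p.1 * p.1.factorial * p.2.factorial) * (-1) ^ p.2 * y ^ (p.1 + p.2) =
      hypergeometricTerm A (A - c + 1) c m * y ^ m := by
    intro m
    -- For `k + j = m` one has `(A)_(2k+j) = (A)_m (A+m)_k`, so the diagonal sum is Chu–Vandermonde
    -- with `B = A + m`.
    have hV := sum_choose_mul_risingFactorial_div m (B := A + m) hc
    have hrefl : ∀ m : ℕ, risingFactorial (c - (A + m)) m =
        (-1) ^ m * risingFactorial (A - c + 1) m := by
      intro m
      rw [risingFactorial, risingFactorial, ← Finset.prod_range_reflect, ← Finset.card_range m,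
        ← Finset.prod_const, Finset.card_range, ← Finset.prod_mul_distrib]
      refine Finset.prod_congr rfl fun i hi => ?_
      have hi' := Finset.mem_range.mp hi
      rw [Nat.sub_sub, Nat.cast_sub (by omega)]
      push_cast
      ring
    rw [hrefl] at hV
    have hV' : risingFactorial (A - c + 1) m / risingFactorial c m = (-1) ^ m *
        ∑ p ∈ Finset.HasAntidiagonal.antidiagonal m,
        (m.choose p.1 : ℂ) * ((-1) ^ p.1 * (risingFactorial (A + m) p.1 / risingFactorial c p.1)) := by
      rw [hV, ← mul_div_assoc, ← mul_assoc, ← mul_pow]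
      simp
    have : hypergeometricTerm A (A - c + 1) c m =
        risingFactorial A m / m.factorial *
          (risingFactorial (A - c + 1) m / risingFactorial c m) := by
      rw [hypergeometricTerm, div_mul_div_comm, mul_comm (m.factorial : ℂ)]
    rw [this, hV', Finset.mul_sum, Finset.mul_sum, Finset.sum_mul]
    refine Finset.sum_congr rfl fun p hp => ?_
    obtain ⟨k, j⟩ := p
    obtain rfl : k + j = m := Finset.HasAntidiagonal.mem_antidiagonal.mp hp
    have hch : (((k + j).choose k : ℕ) : ℂ) * k.factorial * j.factorial = (k + j).factorial := by
      have := Nat.add_choose_mul_factorial_mul_factorial k j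
      rw [← Nat.choose_symm_add] at this
      exact_mod_cast this
    have hsgn : (-1 : ℂ) ^ (k + j) * (-1) ^ k = (-1) ^ j := by
      rw [pow_add, mul_right_comm, ← mul_pow]
      simp
    simp only
    rw [show 2 * k + j = (k + j) + k by ring, risingFactorial_add, ← hch, ← hsgn]
    have := risingFactorial_ne_zero hc k
    have := Nat.factorial_ne_zero k
    have := Nat.factorial_ne_zero j
    have : ((k + j).choose k : ℂ) ≠ 0 := by
      exact_mod_cast (Nat.choose_pos (Nat.le_add_right k j)).ne'
    field_simp
  have hright' : S = ordinaryHypergeometric A (A - c + 1) c y := by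
    rw [ordinaryHypergeometric_eq_tsum_hypergeometricTerm, ← hright.tsum_eq]
    exact tsum_congr e
  rw [← hright', ordinaryHypergeometric_eq_tsum_hypergeometricTerm, ← hleft.tsum_eq,
    tsum_mul_left, ← mul_assoc, ← cpow_add _ _ hy0]
  simp

/-! ### Additivity of the principal logarithm. -/

theorem arg_eq_zero_of_mem_slitPlane {a : ℂ} (ha : a ∈ slitPlane) (h : a.im = 0) : arg a = 0 := by
  have hre : 0 < a.re := (mem_slitPlane_iff.mp ha).resolve_right (fun h' => h' h)
  exact arg_eq_zero_iff.mpr ⟨hre.le, h⟩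

theorem abs_arg_lt_pi {a : ℂ} (ha : a ∈ slitPlane) : -Real.pi < arg a ∧ arg a < Real.pi :=
  ⟨neg_pi_lt_arg a, lt_of_le_of_ne (arg_le_pi a) (mem_slitPlane_iff_arg.mp ha).1⟩

/-- Arguments of opposite sign cannot add up to leave the principal range. -/
theorem log_mul_of_im_mul_im_nonpos {a b : ℂ} (ha : a ∈ slitPlane) (hb : b ∈ slitPlane)
    (h : a.im * b.im ≤ 0) : log (a * b) = log a + log b := by
  have ha' := abs_arg_lt_pi ha
  have hb' := abs_arg_lt_pi hb
  refine log_mul (slitPlane_ne_zero ha) (slitPlane_ne_zero hb) ?_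
  rcases lt_trichotomy a.im 0 with h1 | h1 | h1
  · have hb0 : 0 ≤ b.im := by
      by_contra hc
      nlinarith
    have h2 := arg_neg_iff.mpr h1
    have h3 := arg_nonneg_iff.mpr hb0
    constructor <;> linarith
  · rw [arg_eq_zero_of_mem_slitPlane ha h1, zero_add]
    exact ⟨hb'.1, hb'.2.le⟩
  · have hb0 : b.im ≤ 0 := by
      by_contra hc
      nlinarith
    have h2 := arg_nonneg_iff.mpr h1.le
    have h3 : arg b ≤ 0 := by
      rcases hb0.lt_or_eq with h4 | h4
      · exact (arg_neg_iff.mpr h4).le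
      · exact (arg_eq_zero_of_mem_slitPlane hb h4).le
    constructor <;> linarith

theorem log_mul_of_re_pos {a b : ℂ} (ha : 0 < a.re) (hb : 0 < b.re) :
    log (a * b) = log a + log b := by
  have h1 := abs_lt.mp (abs_arg_lt_pi_div_two_iff.mpr (Or.inl ha))
  have h2 := abs_lt.mp (abs_arg_lt_pi_div_two_iff.mpr (Or.inl hb))
  refine log_mul (fun h => ?_) (fun h => ?_) ⟨by linarith, by linarith⟩
  · simp [h] at ha
  · simp [h] at hb

theorem mul_mem_slitPlane_of_re_pos {a b : ℂ} (ha : 0 < a.re) (hb : 0 < b.re) :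
    a * b ∈ slitPlane := by
  have h1 := abs_lt.mp (abs_arg_lt_pi_div_two_iff.mpr (Or.inl ha))
  have h2 := abs_lt.mp (abs_arg_lt_pi_div_two_iff.mpr (Or.inl hb))
  have ha0 : a ≠ 0 := fun h => by simp [h] at ha
  have hb0 : b ≠ 0 := fun h => by simp [h] at hb
  refine mem_slitPlane_iff_arg.mpr ⟨?_, mul_ne_zero ha0 hb0⟩
  rw [arg_mul ha0 hb0 ⟨by linarith, by linarith⟩]
  linarith

theorem re_one_sub_pos {a : ℂ} (ha : ‖a‖ < 1) : 0 < (1 - a).re := by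
  have := (re_le_norm a).trans_lt ha
  simpa using this

theorem re_one_add_pos {a : ℂ} (ha : ‖a‖ < 1) : 0 < (1 + a).re := by
  simpa using re_one_sub_pos (a := -a) (by simpa using ha)

/-! ### The Joukowski map from the slit disc onto the cut plane. -/

/-- The Joukowski map. -/
def joukowski (ρ : ℂ) : ℂ := (1 + ρ ^ 2) / (2 * ρ)

theorem joukowski_mul {ρ : ℂ} (h : ρ ≠ 0) : joukowski ρ * (2 * ρ) = 1 + ρ ^ 2 := by
  unfold joukowski
  field_simp

theorem joukowski_eq_of {ρ z : ℂ} (h : ρ ≠ 0) (hz : z * (2 * ρ) = 1 + ρ ^ 2) :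
    z = joukowski ρ := by
  rw [joukowski, ← hz]
  field_simp

/-- Eliminating the real part from the real and imaginary parts of `joukowski_mul` gives this; for
`‖ρ‖ < 1` it shows that the map exchanges the half-planes. -/
theorem joukowski_im {ρ : ℂ} (h : ρ ≠ 0) :
    (joukowski ρ).im * (2 * ‖ρ‖ ^ 2) = ρ.im * (‖ρ‖ ^ 2 - 1) := by
  have h1 := joukowski_mul h
  have hre := congrArg re h1
  have him := congrArg im h1
  simp only [mul_re, mul_im, add_re, add_im, one_re, one_im, pow_two, re_ofNat, im_ofNat] at hre him
  rw [← normSq_eq_norm_sq, normSq_apply]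
  linear_combination ρ.re * him - ρ.im * hre

/-- The roots `x ± s` of `w² - 2xw + 1`, where `s² = x² - 1`, have product one, so one of them lies
in the closed unit disc. -/
theorem exists_eq_joukowski (x : ℂ) : ∃ w : ℂ, w ≠ 0 ∧ ‖w‖ ≤ 1 ∧ x = joukowski w := by
  obtain ⟨s, hs⟩ := IsAlgClosed.exists_pow_nat_eq (x ^ 2 - 1) two_pos
  have h0 : (x - s) * (x + s) = 1 := by linear_combination -hs
  have hm : x - s ≠ 0 := left_ne_zero_of_mul_eq_one h0
  have hp : x + s ≠ 0 := right_ne_zero_of_mul_eq_one h0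
  rcases le_total ‖x - s‖ 1 with h | h
  · exact ⟨x - s, hm, h, joukowski_eq_of hm (by linear_combination h0)⟩
  · refine ⟨x + s, hp, ?_, joukowski_eq_of hp (by linear_combination h0)⟩
    have := congrArg norm h0
    rw [norm_mul, norm_one] at this
    nlinarith [norm_nonneg (x + s)]

/-- The preimages to exclude are the nonpositive real axis, which gives real values that are not
above one, and the unit circle, which gives values in `[-1, 1]`. -/
theorem exists_eq_joukowski_of_mem_cutPlane {z : ℂ} (hz : z ∈ cutPlane) :
    ∃ ρ : ℂ, ρ ∈ slitPlane ∧ ‖ρ‖ < 1 ∧ z = joukowski ρ := by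
  obtain ⟨ρ, h0, h1, rfl⟩ := exists_eq_joukowski z
  have him := joukowski_im h0
  have hpos : 0 < ‖ρ‖ := norm_pos_iff.mpr h0
  have hre := congrArg re (joukowski_mul h0)
  simp only [mul_re, mul_im, add_re, one_re, pow_two, re_ofNat, im_ofNat] at hre
  have hn : ‖ρ‖ ^ 2 = ρ.re * ρ.re + ρ.im * ρ.im := by rw [← normSq_eq_norm_sq, normSq_apply]
  refine ⟨ρ, ?_, lt_of_le_of_ne h1 fun h => ?_, rfl⟩
  · by_contra hs
    rw [mem_slitPlane_iff, not_or, not_lt, not_not] at hs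
    have : (joukowski ρ).im = 0 := by
      rw [hs.2, zero_mul] at him
      exact (mul_eq_zero.mp him).resolve_right (by positivity)
    have h2 := hz.resolve_right (fun h => h this)
    rw [this, hs.2] at hre
    nlinarith [hs.1]
  · rw [h] at him hn
    have : (joukowski ρ).im = 0 := by linarith
    have h2 := hz.resolve_right (fun h => h this)
    rw [this] at hre
    -- On the unit circle `1 - ρ.im² = ρ.re²`. So either the value is `ρ.re ≤ 1`, or `ρ = ±i` and
    -- the value is zero.
    have h3 : (joukowski ρ).re * ρ.re = ρ.re * ρ.re := by nlinarith
    rcases mul_eq_mul_right_iff.mp h3 with h4 | h4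
    · nlinarith [mul_self_nonneg ρ.im]
    · have := joukowski_mul h0
      have e2 : ρ ^ 2 = -1 := by
        apply Complex.ext
        · simp [pow_two, h4]; nlinarith
        · simp [pow_two, h4]
      rw [e2] at this
      have h5 : joukowski ρ = 0 := by
        simpa [h0] using this
      rw [h5] at h2
      norm_num at h2

theorem joukowski_im_mul_im_nonpos {ρ : ℂ} (hρ : ρ ∈ slitPlane) (hρ1 : ‖ρ‖ < 1) :
    (joukowski ρ).im * (2 * ρ).im ≤ 0 := by
  have h0 := slitPlane_ne_zero hρ
  have him := joukowski_im h0
  have hpos : 0 < ‖ρ‖ := norm_pos_iff.mpr h0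
  have h1 : (joukowski ρ).im = ρ.im * (‖ρ‖ ^ 2 - 1) / (2 * ‖ρ‖ ^ 2) := by
    rw [← him]
    field_simp
  have h2 : (joukowski ρ).im * (2 * ρ).im = -(ρ.im ^ 2 * (1 - ‖ρ‖ ^ 2) / ‖ρ‖ ^ 2) := by
    rw [h1]
    simp only [mul_im, re_ofNat, im_ofNat]
    field_simp
    ring
  rw [h2, neg_nonpos]
  have : ‖ρ‖ ^ 2 ≤ 1 := by nlinarith
  exact div_nonneg (mul_nonneg (sq_nonneg _) (by linarith)) (sq_nonneg _)

theorem joukowski_mem_cutPlane {ρ : ℂ} (hρ : ρ ∈ slitPlane) (hρ1 : ‖ρ‖ < 1) :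
    joukowski ρ ∈ cutPlane := by
  have h0 := slitPlane_ne_zero hρ
  have him := joukowski_im h0
  have hpos : 0 < ‖ρ‖ := norm_pos_iff.mpr h0
  by_cases h : ρ.im = 0
  · left
    have hr : 0 < ρ.re := (mem_slitPlane_iff.mp hρ).resolve_right (fun h' => h' h)
    have hr1 : ρ.re < 1 := (re_le_norm ρ).trans_lt hρ1
    have hre := congrArg re (joukowski_mul h0)
    simp only [mul_re, mul_im, add_re, one_re, pow_two, re_ofNat, im_ofNat, h] at hre
    by_contra hc
    rw [not_lt] at hc
    nlinarith [mul_le_mul_of_nonneg_right hc hr.le, mul_pos (sub_pos.mpr hr1) (sub_pos.mpr hr1)]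
  · right
    intro hz
    rw [hz, zero_mul] at him
    rcases mul_eq_zero.mp him.symm with h1 | h1
    · exact h h1
    · nlinarith

theorem two_mul_mem_slitPlane {ρ : ℂ} (hρ : ρ ∈ slitPlane) : 2 * ρ ∈ slitPlane := by
  rw [mem_slitPlane_iff] at hρ ⊢
  simpa using hρ

theorem log_one_add_sq_eq {ρ : ℂ} (hρ : ρ ∈ slitPlane) (hρ1 : ‖ρ‖ < 1) :
    log (1 + ρ ^ 2) = log (joukowski ρ) + log (2 * ρ) := by
  rw [← joukowski_mul (slitPlane_ne_zero hρ)]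
  refine log_mul_of_im_mul_im_nonpos ?_ (two_mul_mem_slitPlane hρ)
    (joukowski_im_mul_im_nonpos hρ hρ1)
  rw [mem_slitPlane_iff]
  exact (joukowski_mem_cutPlane hρ hρ1).imp (fun h => by linarith) id

/-- Take logarithms in `(1 - ρ)² = (z - 1) * 2ρ`: on the left both factors are in the right
half-plane, on the right the factors have imaginary parts of opposite sign. -/
theorem log_joukowski_sub_one {ρ : ℂ} (hρ : ρ ∈ slitPlane) (hρ1 : ‖ρ‖ < 1) :
    log (joukowski ρ - 1) = 2 * log (1 - ρ) - log (2 * ρ) := by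
  have h1 := re_one_sub_pos hρ1
  have h2 := log_mul_of_re_pos h1 h1
  have h3 : (1 - ρ) * (1 - ρ) = (joukowski ρ - 1) * (2 * ρ) := by
    linear_combination -joukowski_mul (slitPlane_ne_zero hρ)
  rw [h3, log_mul_of_im_mul_im_nonpos ?_ (two_mul_mem_slitPlane hρ)
    (by simpa using joukowski_im_mul_im_nonpos hρ hρ1)] at h2
  · linear_combination h2
  · rw [mem_slitPlane_iff]
    simpa [cutPlane] using joukowski_mem_cutPlane hρ hρ1

theorem log_joukowski_add_one {ρ : ℂ} (hρ : ρ ∈ slitPlane) (hρ1 : ‖ρ‖ < 1) :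
    log (joukowski ρ + 1) = 2 * log (1 + ρ) - log (2 * ρ) := by
  have h1 := re_one_add_pos hρ1
  have h2 := log_mul_of_re_pos h1 h1
  have h3 : (1 + ρ) * (1 + ρ) = (joukowski ρ + 1) * (2 * ρ) := by
    linear_combination -joukowski_mul (slitPlane_ne_zero hρ)
  rw [h3, log_mul_of_im_mul_im_nonpos ?_ (two_mul_mem_slitPlane hρ)
    (by simpa using joukowski_im_mul_im_nonpos hρ hρ1)] at h2
  · linear_combination h2
  · rw [mem_slitPlane_iff]
    refine (joukowski_mem_cutPlane hρ hρ1).imp (fun h => ?_) (fun h => ?_)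
    · simp only [add_re, one_re]
      linarith
    · simpa using h

theorem log_joukowski_sub_one_add_log_joukowski_add_one {ρ : ℂ} (hρ : ρ ∈ slitPlane) (hρ1 : ‖ρ‖ < 1) :
    log (joukowski ρ - 1) + log (joukowski ρ + 1) = 2 * (log (1 - ρ ^ 2) - log (2 * ρ)) := by
  rw [log_joukowski_sub_one hρ hρ1, log_joukowski_add_one hρ hρ1,
    show 1 - ρ ^ 2 = (1 - ρ) * (1 + ρ) by ring,
    log_mul_of_re_pos (re_one_sub_pos hρ1) (re_one_add_pos hρ1)]
  ring

theorem one_sub_sq_ne_zero {ρ : ℂ} (hρ1 : ‖ρ‖ < 1) : 1 - ρ ^ 2 ≠ 0 := by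
  intro h
  have h2 : ‖ρ ^ 2‖ < 1 := by
    rw [norm_pow]
    nlinarith [norm_nonneg ρ]
  have h3 := re_one_sub_pos h2
  simp [h] at h3

theorem one_add_sq_ne_zero {ρ : ℂ} (hρ1 : ‖ρ‖ < 1) : 1 + ρ ^ 2 ≠ 0 := by
  intro h
  have h2 : ‖ρ ^ 2‖ < 1 := by
    rw [norm_pow]
    nlinarith [norm_nonneg ρ]
  have h3 := re_one_add_pos h2
  simp [h] at h3

theorem sqSubOnePow_joukowski {ρ : ℂ} (hρ : ρ ∈ slitPlane) (hρ1 : ‖ρ‖ < 1)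
    (a : ℂ) :
    sqSubOnePow (joukowski ρ) a = (1 - ρ ^ 2) ^ (2 * a) / (2 * ρ) ^ (2 * a) := by
  have h0 := slitPlane_ne_zero (two_mul_mem_slitPlane hρ)
  have hz := joukowski_mem_cutPlane hρ hρ1
  have h1 : joukowski ρ - 1 ≠ 0 := by
    intro h
    rw [sub_eq_zero.mp h] at hz
    simp [cutPlane] at hz
  have h2 : joukowski ρ + 1 ≠ 0 := by
    intro h
    rw [eq_neg_of_add_eq_zero_left h] at hz
    simp [cutPlane] at hz
    linarith
  have h3 := log_joukowski_sub_one_add_log_joukowski_add_one hρ hρ1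
  rw [sqSubOnePow, cpow_def_of_ne_zero h1, cpow_def_of_ne_zero h2,
    cpow_def_of_ne_zero (one_sub_sq_ne_zero hρ1), cpow_def_of_ne_zero h0, ← exp_add, ← exp_sub]
  congr 1
  linear_combination a * h3

theorem joukowski_cpow {ρ : ℂ} (hρ : ρ ∈ slitPlane) (hρ1 : ‖ρ‖ < 1)
    (a : ℂ) :
    joukowski ρ ^ a = (1 + ρ ^ 2) ^ a / (2 * ρ) ^ a := by
  have h0 := slitPlane_ne_zero (two_mul_mem_slitPlane hρ)
  rw [cpow_def_of_ne_zero (cutPlane_ne_zero (joukowski_mem_cutPlane hρ hρ1)),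
    cpow_def_of_ne_zero (one_add_sq_ne_zero hρ1), cpow_def_of_ne_zero h0, ← exp_sub,
    log_one_add_sq_eq hρ hρ1]
  congr 1
  ring

/-- This exhibits the inverse map as `z - √(z² - 1)`, whose holomorphy on the cut plane is evident.
-/
theorem joukowski_sub_sqSubOnePow {ρ : ℂ} (hρ : ρ ∈ slitPlane) (hρ1 : ‖ρ‖ < 1) :
    joukowski ρ - sqSubOnePow (joukowski ρ) (1 / 2) = ρ := by
  have h0 := slitPlane_ne_zero hρ
  rw [sqSubOnePow_joukowski hρ hρ1, joukowski]
  norm_num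
  field_simp
  ring

/-! ### The Legendre function as a function of `ρ`. -/

theorem isOpen_cutPlane : IsOpen cutPlane :=
  (isOpen_lt continuous_const continuous_re).union (isOpen_ne_fun continuous_im continuous_const)

theorem differentiableOn_sqSubOnePow (a : ℂ) :
    DifferentiableOn ℂ (fun z => sqSubOnePow z a) cutPlane := by
  intro z hz
  refine DifferentiableAt.differentiableWithinAt ?_
  unfold sqSubOnePow
  refine DifferentiableAt.mul (DifferentiableAt.cpow (by fun_prop) (by fun_prop) ?_)
    (DifferentiableAt.cpow (by fun_prop) (by fun_prop) ?_)
  · rw [mem_slitPlane_iff]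
    simpa [cutPlane] using hz
  · rw [mem_slitPlane_iff]
    refine hz.imp (fun h => ?_) (fun h => ?_)
    · simp only [add_re, one_re]
      linarith
    · simpa using h

theorem cutPlane_subset_slitPlane : cutPlane ⊆ slitPlane := fun _ hz =>
  mem_slitPlane_iff.mpr (hz.imp (fun h => by linarith) id)

/-- The region is the exponential image of a convex half-strip. Connectedness is what lets the
identity theorem reach every point where the defining series is prescribed. -/
theorem isPreconnected_cutPlane_inter_exterior :
    IsPreconnected (cutPlane ∩ {z | 1 < ‖z‖}) := by
  have himage : cutPlane ∩ {z | 1 < ‖z‖} =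
      exp '' ({w | 0 < w.re} ∩ ({w | -Real.pi < w.im} ∩ {w | w.im < Real.pi})) := by
    ext z
    constructor
    · rintro ⟨hz, hz1⟩
      have h := abs_arg_lt_pi (cutPlane_subset_slitPlane hz)
      refine ⟨log z, ⟨?_, ?_, ?_⟩, exp_log (cutPlane_ne_zero hz)⟩
      · simpa [log_re] using Real.log_pos hz1
      · simpa [log_im] using h.1
      · simpa [log_im] using h.2
    · rintro ⟨w, ⟨h1, h2, h3⟩, rfl⟩
      have hn : 1 < ‖exp w‖ := by
        rw [norm_exp]
        exact Real.one_lt_exp_iff.mpr h1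
      refine ⟨?_, hn⟩
      by_cases him : (exp w).im = 0
      · left
        have harg : arg (exp w) = w.im := by
          rw [← log_im, log_exp h2 (le_of_lt h3)]
        have hs : exp w ∈ slitPlane :=
          mem_slitPlane_iff_arg.mpr ⟨by rw [harg]; exact ne_of_lt h3, exp_ne_zero w⟩
        have hre : 0 < (exp w).re := (mem_slitPlane_iff.mp hs).resolve_right (fun h' => h' him)
        have : exp w = ((exp w).re : ℂ) := Complex.ext (by simp) (by simpa using him)
        rwa [this, norm_real, Real.norm_of_nonneg hre.le] at hn
      · exact Or.inr him
  rw [himage]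
  refine Convex.isPreconnected ?_ |>.image _ continuous_exp.continuousOn
  exact (convex_halfSpace_re_gt 0).inter
    ((convex_halfSpace_im_gt _).inter (convex_halfSpace_im_lt _))

/-- The associated Legendre function of the second kind at `joukowski ρ`, in terms of `ρ`. -/
def legendreQNome (α β ρ : ℂ) : ℂ :=
  (Real.sqrt Real.pi : ℂ) * exp (I * Real.pi * β) * Gamma (α + β + 1) / Gamma (α + 3 / 2) *
    (1 - ρ ^ 2) ^ β * ρ ^ (α + 1) *
    ordinaryHypergeometric (α + β + 1) (β + 1 / 2) (α + 3 / 2) (ρ ^ 2)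

theorem norm_sq_lt_one {ρ : ℂ} (hρ1 : ‖ρ‖ < 1) : ‖ρ ^ 2‖ < 1 := by
  rw [norm_pow]
  nlinarith [norm_nonneg ρ]

/-- Since `1 / z² = 4ρ² / (1 + ρ²)²`, the quadratic transformation applies with `y = ρ²`, `A = α + β
+ 1`, `c = α + 3/2`; its factor `(1 + ρ²) ^ A` cancels against the power of `z`. -/
theorem legendreQSeries_joukowski {α β ρ : ℂ} (hα : ∀ k : ℕ, α + 3 / 2 + k ≠ 0)
    (hρ : ρ ∈ slitPlane) (hρ1 : ‖ρ‖ < 1) (hρ2 : ‖ρ ^ 2‖ < 1 / 200) :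
    legendreQSeries α β (joukowski ρ) = legendreQNome α β ρ := by
  have h0 := slitPlane_ne_zero hρ
  have h1 := one_add_sq_ne_zero hρ1
  have hinv : 1 / joukowski ρ ^ 2 = 4 * ρ ^ 2 / (1 + ρ ^ 2) ^ 2 := by
    unfold joukowski
    field_simp
    ring
  have hq := ordinaryHypergeometric_quadratic (α + β + 1) hα hρ2
  rw [legendreQSeries, hinv, show (α + β + 2) / 2 = (α + β + 1 + 1) / 2 by ring, hq,
    sqSubOnePow_joukowski hρ hρ1, joukowski_cpow hρ hρ1, legendreQNome,
    show 2 * (β / 2) = β by ring, show α + β + 1 - (α + 3 / 2) + 1 = β + 1 / 2 by ring]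
  have h2ρ := slitPlane_ne_zero (two_mul_mem_slitPlane hρ)
  have e1 : (2 * ρ) ^ (α + β + 1) = 2 ^ (α + 1) * ρ ^ (α + 1) * (2 * ρ) ^ β := by
    rw [show α + β + 1 = (α + 1) + β by ring, cpow_add _ _ h2ρ]
    congr 1
    have h2 : log (2 * ρ) = log 2 + log ρ :=
      log_mul_of_im_mul_im_nonpos (by simp) hρ (by simp)
    rw [cpow_def_of_ne_zero h2ρ, h2, cpow_def_of_ne_zero two_ne_zero, cpow_def_of_ne_zero h0,
      ← exp_add]
    congr 1
    ring
  rw [e1]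
  have n1 : (2 : ℂ) ^ (α + 1) ≠ 0 := by simp [cpow_eq_zero_iff]
  have n2 : (2 * ρ) ^ β ≠ 0 := by
    rw [Ne, cpow_eq_zero_iff]
    exact fun h => h2ρ h.1
  have n3 : (1 + ρ ^ 2) ^ (α + β + 1) ≠ 0 := by
    rw [Ne, cpow_eq_zero_iff]
    exact fun h => h1 h.1
  by_cases hG : Gamma (α + 3 / 2) = 0
  · simp [hG]
  field_simp

theorem differentiableOn_legendreQNome (α β : ℂ) :
    DifferentiableOn ℂ (legendreQNome α β) (slitPlane ∩ {ρ | ‖ρ‖ < 1}) := by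
  intro ρ hρ
  have h2 := norm_sq_lt_one hρ.2
  have hF : DifferentiableAt ℂ (fun ρ : ℂ => (ordinaryHypergeometric (α + β + 1) (β + 1 / 2)
      (α + 3 / 2) (ρ ^ 2) : ℂ)) ρ := by
    have h := (differentiableOn_ordinaryHypergeometric (α + β + 1) (β + 1 / 2)
      (α + 3 / 2)).differentiableAt (Metric.isOpen_ball.mem_nhds (mem_ball_zero_iff.mpr h2))
    exact h.comp ρ (by fun_prop : DifferentiableAt ℂ (fun ρ : ℂ => ρ ^ 2) ρ)
  refine DifferentiableAt.differentiableWithinAt ?_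
  unfold legendreQNome
  refine DifferentiableAt.mul (DifferentiableAt.mul (DifferentiableAt.const_mul
    (DifferentiableAt.cpow (by fun_prop) (by fun_prop) ?_) _)
    (DifferentiableAt.cpow (by fun_prop) (by fun_prop) hρ.1)) hF
  exact mem_slitPlane_iff.mpr (Or.inl (re_one_sub_pos h2))

/-- The inverse of the Joukowski map on the cut plane. -/
def joukowskiInv (z : ℂ) : ℂ := z - sqSubOnePow z (1 / 2)

theorem joukowskiInv_mem {z : ℂ} (hz : z ∈ cutPlane) :
    joukowskiInv z ∈ slitPlane ∩ {ρ | ‖ρ‖ < 1} ∧ joukowski (joukowskiInv z) = z := by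
  obtain ⟨ρ, hρ, hρ1, rfl⟩ := exists_eq_joukowski_of_mem_cutPlane hz
  rw [joukowskiInv, joukowski_sub_sqSubOnePow hρ hρ1]
  exact ⟨⟨hρ, hρ1⟩, rfl⟩

theorem differentiableOn_joukowskiInv : DifferentiableOn ℂ joukowskiInv cutPlane :=
  differentiableOn_id.sub (differentiableOn_sqSubOnePow _)

theorem differentiableOn_legendreQSeries (α β : ℂ) :
    DifferentiableOn ℂ (legendreQSeries α β) (cutPlane ∩ {z | 1 < ‖z‖}) := by
  intro z hz
  have hz0 := cutPlane_ne_zero hz.1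
  have hz1 : ‖1 / z ^ 2‖ < 1 := by
    have h1 : (1 : ℝ) < ‖z‖ := hz.2
    rw [norm_div, norm_one, norm_pow, div_lt_one (by positivity)]
    nlinarith
  have hF : DifferentiableAt ℂ (fun z : ℂ => (ordinaryHypergeometric ((α + β + 2) / 2)
      ((α + β + 1) / 2) (α + 3 / 2) (1 / z ^ 2) : ℂ)) z := by
    have h := (differentiableOn_ordinaryHypergeometric ((α + β + 2) / 2) ((α + β + 1) / 2)
      (α + 3 / 2)).differentiableAt (Metric.isOpen_ball.mem_nhds (mem_ball_zero_iff.mpr hz1))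
    refine h.comp z (f := fun z : ℂ => 1 / z ^ 2) ?_
    exact DifferentiableAt.div (by fun_prop) (by fun_prop) (pow_ne_zero 2 hz0)
  have hs := (differentiableOn_sqSubOnePow (β / 2)).differentiableAt
    (isOpen_cutPlane.mem_nhds hz.1)
  have hp : DifferentiableAt ℂ (fun z : ℂ => (z ^ (α + β + 1))⁻¹) z := by
    refine DifferentiableAt.inv (DifferentiableAt.cpow (by fun_prop) (by fun_prop)
      (cutPlane_subset_slitPlane hz.1)) ?_
    rw [Ne, cpow_eq_zero_iff]
    exact fun h => hz0 h.1
  have := ((hs.const_mul ((Real.sqrt Real.pi : ℂ) * exp (I * Real.pi * β) * Gamma (α + β + 1) /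
    ((2 : ℂ) ^ (α + 1) * Gamma (α + 3 / 2)))).mul hp).mul hF
  refine DifferentiableAt.differentiableWithinAt
    (this.congr_of_eventuallyEq (Filter.Eventually.of_forall fun w => ?_))
  simp only [legendreQSeries, Pi.mul_apply, div_eq_mul_inv, mul_inv]
  ring

theorem isLegendreQ_legendreQNome {α : ℂ} (hα : ∀ k : ℕ, α + 3 / 2 + k ≠ 0) (β : ℂ) :
    IsLegendreQ α β fun z => legendreQNome α β (joukowskiInv z) := by
  have hdiff : DifferentiableOn ℂ (fun z => legendreQNome α β (joukowskiInv z)) cutPlane :=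
    (differentiableOn_legendreQNome α β).comp differentiableOn_joukowskiInv
      fun z hz => (joukowskiInv_mem hz).1
  refine ⟨hdiff, fun z hz hz1 => ?_⟩
  have hW : IsOpen (cutPlane ∩ {z : ℂ | 1 < ‖z‖}) :=
    isOpen_cutPlane.inter (isOpen_lt continuous_const continuous_norm)
  -- A base point for the identity theorem: its square `1 / 1600` is below `1 / 200`, and its image
  -- has norm larger than one.
  have hc : (1 / 40 : ℂ) ∈ slitPlane := by
    rw [mem_slitPlane_iff]
    norm_num
  have hc1 : ‖(1 / 40 : ℂ)‖ < 1 := by norm_num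
  have hz0 := joukowski_mem_cutPlane hc hc1
  have hz01 : 1 < ‖joukowski (1 / 40)‖ := by
    unfold joukowski
    norm_num
  have hev : (fun z => legendreQNome α β (joukowskiInv z)) =ᶠ[nhds (joukowski (1 / 40))]
      legendreQSeries α β := by
    have hcont : ContinuousAt (fun z => ‖joukowskiInv z ^ 2‖) (joukowski (1 / 40)) :=
      ((differentiableOn_joukowskiInv.differentiableAt
        (isOpen_cutPlane.mem_nhds hz0)).continuousAt.pow 2).norm
    have hlt : ‖joukowskiInv (joukowski (1 / 40)) ^ 2‖ < 1 / 200 := by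
      rw [joukowskiInv, joukowski_sub_sqSubOnePow hc hc1]
      norm_num
    filter_upwards [hcont.eventually_lt_const hlt, isOpen_cutPlane.mem_nhds hz0] with z h1 h2
    obtain ⟨h3, h4⟩ := joukowskiInv_mem h2
    have := legendreQSeries_joukowski (β := β) hα h3.1 h3.2 h1
    rw [← this, h4]
  exact ((hdiff.mono Set.inter_subset_left).analyticOnNhd hW).eqOn_of_preconnected_of_eventuallyEq
    ((differentiableOn_legendreQSeries α β).analyticOnNhd hW)
    isPreconnected_cutPlane_inter_exterior ⟨hz0, hz01⟩ hev ⟨hz, hz1⟩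

theorem legendreQ_joukowski {α ρ : ℂ} (hα : ∀ k : ℕ, α + 3 / 2 + k ≠ 0) (β : ℂ)
    (hρ : ρ ∈ slitPlane) (hρ1 : ‖ρ‖ < 1) :
    legendreQ α β (joukowski ρ) = legendreQNome α β ρ := by
  rw [legendreQ_eq_of_isLegendreQ (isLegendreQ_legendreQNome hα β)
    (joukowski_mem_cutPlane hρ hρ1)]
  simp only [joukowskiInv, joukowski_sub_sqSubOnePow hρ hρ1]

/-! ### Gegenbauer polynomials in Laurent form. -/

/-- The coefficient of `ρ ^ n` in `(1 - ρ w) ^ (-ν) * (1 - ρ w⁻¹) ^ (-ν)`. -/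
def gegenbauerLaurent (ν w : ℂ) (n : ℕ) : ℂ :=
  ∑ p ∈ Finset.HasAntidiagonal.antidiagonal n,
    (risingFactorial ν p.1 / p.1.factorial * w ^ p.1) *
      (risingFactorial ν p.2 / p.2.factorial * w⁻¹ ^ p.2)

theorem gegenbauerLaurent_zero (ν w : ℂ) : gegenbauerLaurent ν w 0 = 1 := by
  simp [gegenbauerLaurent, risingFactorial_zero]

theorem gegenbauerLaurent_one (ν w : ℂ) (hw : w ≠ 0) :
    gegenbauerLaurent ν w 1 = 2 * ν * joukowski w := by
  simp [gegenbauerLaurent, risingFactorial, joukowski,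
    Finset.HasAntidiagonal.antidiagonal]
  field_simp

open PowerSeries in
-- The generating function `G` satisfies `(1 - 2xX + X²) G' = 2ν (x - X) G` with `x = joukowski w`;
-- the recurrence is its coefficient at `X ^ (n + 1)`.
theorem gegenbauerLaurent_rec (ν : ℂ) {w : ℂ} (hw : w ≠ 0) (n : ℕ) :
    ((n : ℂ) + 2) * gegenbauerLaurent ν w (n + 2) =
      2 * (n + 1 + ν) * joukowski w * gegenbauerLaurent ν w (n + 1) -
        (n + 2 * ν) * gegenbauerLaurent ν w n := by
  -- The formal power series of `(1 - w X) ^ (-ν)`, characterized by its first-order differential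
  -- equation.
  let U : ℂ → PowerSeries ℂ := fun w =>
    PowerSeries.mk fun j => risingFactorial ν j / j.factorial * w ^ j
  have hU : ∀ w : ℂ, (1 - PowerSeries.C w * X) * d⁄dX ℂ (U w) = PowerSeries.C (ν * w) * U w := by
    intro w
    ext j
    rw [sub_mul, one_mul, mul_assoc, map_sub, coeff_C_mul, coeff_C_mul]
    cases j with
    | zero =>
      simp [U, coeff_derivative, risingFactorial]
    | succ j =>
      rw [coeff_succ_X_mul, coeff_derivative, coeff_derivative]
      simp only [U, coeff_mk, risingFactorial_succ, Nat.factorial_succ]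
      have := Nat.factorial_ne_zero j
      have h1 : (j : ℂ) + 1 ≠ 0 := by exact_mod_cast Nat.succ_ne_zero j
      have h2 : (j : ℂ) + 1 + 1 ≠ 0 := by exact_mod_cast Nat.succ_ne_zero (j + 1)
      push_cast
      field_simp
      ring
  have hG : ∀ n, coeff n (U w * U w⁻¹) = gegenbauerLaurent ν w n := by
    intro n
    rw [coeff_mul]
    simp [U, gegenbauerLaurent]
  have hx : 2 * joukowski w = w + w⁻¹ := by
    unfold joukowski
    field_simp
    ring
  have hprod : (PowerSeries.C w : PowerSeries ℂ) * PowerSeries.C w⁻¹ = 1 := by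
    rw [← map_mul, mul_inv_cancel₀ hw, map_one]
  have key : (1 - PowerSeries.C (2 * joukowski w) * X + X * X) * d⁄dX ℂ (U w * U w⁻¹) =
      PowerSeries.C (2 * ν * joukowski w) * (U w * U w⁻¹) -
        PowerSeries.C (2 * ν) * (X * (U w * U w⁻¹)) := by
    have h1 := hU w
    have h2 := hU w⁻¹
    rw [map_mul] at h1 h2
    have hd : d⁄dX ℂ (U w * U w⁻¹) = U w * d⁄dX ℂ (U w⁻¹) + U w⁻¹ * d⁄dX ℂ (U w) := by
      rw [Derivation.leibniz, smul_eq_mul, smul_eq_mul]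
    have hC2 : (PowerSeries.C (2 : ℂ)) = 2 := map_ofNat _ 2
    rw [show 2 * ν * joukowski w = ν * (2 * joukowski w) by ring, hx, hd,
      map_mul PowerSeries.C ν, map_add PowerSeries.C w, map_mul PowerSeries.C 2, hC2]
    linear_combination (1 - PowerSeries.C w⁻¹ * X) * U w⁻¹ * h1 +
      (1 - PowerSeries.C w * X) * U w * h2 + (- X * X * (U w * d⁄dX ℂ (U w⁻¹)
        + U w⁻¹ * d⁄dX ℂ (U w)) - 2 * PowerSeries.C ν * X * (U w * U w⁻¹)) * hprod
  have h := congrArg (coeff (n + 1)) key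
  rw [add_mul, sub_mul, one_mul, mul_assoc, mul_assoc, map_add, map_sub, map_sub, coeff_C_mul,
    coeff_C_mul, coeff_C_mul, coeff_succ_X_mul, coeff_succ_X_mul, coeff_succ_X_mul,
    coeff_derivative, coeff_derivative, hG, hG, hG] at h
  have h4 : coeff n (X * d⁄dX ℂ (U w * U w⁻¹)) = n * gegenbauerLaurent ν w n := by
    cases n with
    | zero => simp
    | succ n => rw [coeff_succ_X_mul, coeff_derivative, hG]; push_cast; ring
  rw [h4] at h
  push_cast at h
  linear_combination h

theorem eq_of_three_term_recurrence {ν x : ℂ} {p q : ℕ → ℂ} (h0 : p 0 = q 0) (h1 : p 1 = q 1)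
    (hp : ∀ n : ℕ, ((n : ℂ) + 2) * p (n + 2) =
      2 * (n + 1 + ν) * x * p (n + 1) - (n + 2 * ν) * p n)
    (hq : ∀ n : ℕ, ((n : ℂ) + 2) * q (n + 2) =
      2 * (n + 1 + ν) * x * q (n + 1) - (n + 2 * ν) * q n) (n : ℕ) : p n = q n := by
  induction n using Nat.twoStepInduction with
  | zero => exact h0
  | one => exact h1
  | more n ih1 ih2 =>
    have hn : (n : ℂ) + 2 ≠ 0 := by exact_mod_cast Nat.succ_ne_zero (n + 1)
    refine mul_left_cancel₀ hn ?_
    rw [hp, hq, ih1, ih2]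

/-- `1 / (n - k)!`, with the value zero for `n < k`. -/
def invFactorialSub (n k : ℕ) : ℂ := if k ≤ n then ((n - k).factorial : ℂ)⁻¹ else 0

theorem invFactorialSub_succ_succ (n k : ℕ) :
    invFactorialSub (n + 1) (k + 1) = invFactorialSub n k := by
  simp [invFactorialSub]

/-- The factor `n - k` vanishes at `k = n`, so the value zero beyond the degree fits and later
recurrences need no case distinction. -/
theorem invFactorialSub_succ_right (n k : ℕ) :
    invFactorialSub n (k + 1) = (n - k) * invFactorialSub n k := by
  unfold invFactorialSub
  rcases lt_trichotomy k n with h | rfl | h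
  · obtain ⟨d, rfl⟩ := Nat.exists_eq_add_of_lt h
    rw [if_pos (by omega), if_pos (by omega), show k + d + 1 - (k + 1) = d by omega,
      show k + d + 1 - k = d + 1 by omega, Nat.factorial_succ]
    have := Nat.factorial_ne_zero d
    have : (d : ℂ) + 1 ≠ 0 := by exact_mod_cast Nat.succ_ne_zero d
    push_cast
    rw [show (k : ℂ) + d + 1 - k = d + 1 by ring]
    field_simp
  · simp
  · rw [if_neg (by omega), if_neg (by omega), mul_zero]

theorem invFactorialSub_eq_succ_left_mul (n k : ℕ) :
    invFactorialSub n k = (n + 1 - k) * invFactorialSub (n + 1) k := by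
  rw [← invFactorialSub_succ_succ, invFactorialSub_succ_right]
  push_cast
  ring

/-- The coefficient of `((1 - x) / 2) ^ k` in the Gegenbauer polynomial of degree `n`. -/
def gegenbauerCoeff (μ : ℂ) (n k : ℕ) : ℂ :=
  (-1) ^ k * risingFactorial (2 * μ) (n + k) * invFactorialSub n k /
    (risingFactorial (μ + 1 / 2) k * k.factorial)

theorem gegenbauerCoeff_eq_zero (μ : ℂ) {n k : ℕ} (h : n < k) : gegenbauerCoeff μ n k = 0 := by
  simp [gegenbauerCoeff, invFactorialSub, h]

theorem risingFactorial_neg_natCast_div (n k : ℕ) :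
    risingFactorial (-n) k / n.factorial = (-1) ^ k * invFactorialSub n k := by
  induction k with
  | zero => simp [risingFactorial_zero, invFactorialSub]
  | succ k ih =>
    rw [risingFactorial_succ, invFactorialSub_succ_right, mul_div_right_comm, ih]
    ring

/-- Any range beyond the degree is allowed, so three consecutive degrees can be summed over the same
range. -/
theorem gegenbauerC_eq_sum (μ x : ℂ) {n N : ℕ} (hN : n < N) :
    gegenbauerC n μ x = ∑ k ∈ Finset.range N, gegenbauerCoeff μ n k * ((1 - x) / 2) ^ k := by
  have hterm : ∀ k, risingFactorial (2 * μ) n / n.factorial *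
      hypergeometricTerm (-(n : ℂ)) (n + 2 * μ) (μ + 1 / 2) k = gegenbauerCoeff μ n k := by
    intro k
    rw [gegenbauerCoeff, mul_right_comm, ← risingFactorial_neg_natCast_div, risingFactorial_add,
      hypergeometricTerm, add_comm (n : ℂ)]
    ring
  rw [gegenbauerC, ordinaryHypergeometric_eq_tsum_hypergeometricTerm, ← tsum_mul_left]
  change ∑' k, risingFactorial (2 * μ) n / n.factorial * _ = _
  simp only [← mul_assoc, hterm]
  refine tsum_eq_sum fun k hk => ?_
  rw [gegenbauerCoeff_eq_zero μ (by rw [Finset.mem_range] at hk; omega), zero_mul]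

theorem gegenbauerCoeff_rec_zero (μ : ℂ) (n : ℕ) :
    ((n : ℂ) + 2) * gegenbauerCoeff μ (n + 2) 0 =
      2 * (n + 1 + μ) * gegenbauerCoeff μ (n + 1) 0 - (n + 2 * μ) * gegenbauerCoeff μ n 0 := by
  simp only [gegenbauerCoeff]
  rw [invFactorialSub_eq_succ_left_mul n, invFactorialSub_eq_succ_left_mul (n + 1),
    add_zero, add_zero, add_zero, risingFactorial_succ, risingFactorial_succ]
  push_cast
  ring

/-- With `t = (1 - x) / 2`, multiplication by `x = 1 - 2t` subtracts twice the preceding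
coefficient. -/
theorem gegenbauerCoeff_rec_succ {μ : ℂ} (hμ : ∀ k : ℕ, μ + 1 / 2 + k ≠ 0) (n k : ℕ) :
    ((n : ℂ) + 2) * gegenbauerCoeff μ (n + 2) (k + 1) =
      2 * (n + 1 + μ) * (gegenbauerCoeff μ (n + 1) (k + 1) - 2 * gegenbauerCoeff μ (n + 1) k) -
        (n + 2 * μ) * gegenbauerCoeff μ n (k + 1) := by
  simp only [gegenbauerCoeff]
  rw [invFactorialSub_eq_succ_left_mul n (k + 1), invFactorialSub_eq_succ_left_mul (n + 1) (k + 1),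
    ← invFactorialSub_succ_succ (n + 1) k, show n + 2 + (k + 1) = n + k + 1 + 1 + 1 by ring,
    show n + 1 + (k + 1) = n + k + 1 + 1 by ring, show n + 1 + k = n + k + 1 by ring,
    show n + (k + 1) = n + k + 1 by ring]
  simp only [risingFactorial_succ, Nat.factorial_succ]
  have h1 := hμ k
  have h2 := risingFactorial_ne_zero hμ k
  have h3 := Nat.factorial_ne_zero k
  have h4 : (k : ℂ) + 1 ≠ 0 := by exact_mod_cast Nat.succ_ne_zero k
  have h5 : μ * 2 + 1 + 2 * k ≠ 0 := fun h => h1 (by linear_combination h / 2)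
  generalize risingFactorial (μ + 1 / 2) k = H at h2 ⊢
  generalize risingFactorial (2 * μ) (n + k) = S
  generalize invFactorialSub (n + 1 + 1) (k + 1) = E
  -- The denominator `μ + 1/2 + k` becomes `D / 2`, so that clearing denominators leaves a
  -- polynomial identity.
  obtain ⟨D, rfl⟩ : ∃ D, μ = (D - 1 - 2 * k) / 2 := ⟨μ * 2 + 1 + 2 * k, by ring⟩
  have h6 : D ≠ 0 := fun h => h5 (by rw [h]; ring)
  rw [show (D - 1 - 2 * k) / 2 + 1 / 2 + (k : ℂ) = D / 2 by ring]
  push_cast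
  field_simp
  ring

theorem gegenbauerC_rec {μ : ℂ} (hμ : ∀ k : ℕ, μ + 1 / 2 + k ≠ 0) (x : ℂ) (n : ℕ) :
    ((n : ℂ) + 2) * gegenbauerC (n + 2) μ x =
      2 * (n + 1 + μ) * x * gegenbauerC (n + 1) μ x - (n + 2 * μ) * gegenbauerC n μ x := by
  have e1 : x * gegenbauerC (n + 1) μ x = gegenbauerC (n + 1) μ x -
      2 * ((1 - x) / 2 * gegenbauerC (n + 1) μ x) := by ring
  have e2 : (1 - x) / 2 * gegenbauerC (n + 1) μ x =
      ∑ k ∈ Finset.range (n + 2), gegenbauerCoeff μ (n + 1) k * ((1 - x) / 2) ^ (k + 1) := by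
    rw [gegenbauerC_eq_sum μ x (show n + 1 < n + 2 by omega), Finset.mul_sum]
    exact Finset.sum_congr rfl fun k _ => by ring
  rw [mul_assoc (2 * ((n : ℂ) + 1 + μ)), e1, e2,
    gegenbauerC_eq_sum μ x (show n + 2 < n + 2 + 1 by omega),
    gegenbauerC_eq_sum μ x (show n + 1 < n + 2 + 1 by omega),
    gegenbauerC_eq_sum μ x (show n < n + 2 + 1 by omega),
    Finset.sum_range_succ' _ (n + 2), Finset.sum_range_succ' _ (n + 2),
    Finset.sum_range_succ' _ (n + 2)]
  have h : ∑ k ∈ Finset.range (n + 2), ((n : ℂ) + 2) *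
      (gegenbauerCoeff μ (n + 2) (k + 1) * ((1 - x) / 2) ^ (k + 1)) =
      ∑ k ∈ Finset.range (n + 2), (2 * (n + 1 + μ) *
        (gegenbauerCoeff μ (n + 1) (k + 1) * ((1 - x) / 2) ^ (k + 1) -
          2 * (gegenbauerCoeff μ (n + 1) k * ((1 - x) / 2) ^ (k + 1))) -
        (n + 2 * μ) * (gegenbauerCoeff μ n (k + 1) * ((1 - x) / 2) ^ (k + 1))) := by
    refine Finset.sum_congr rfl fun k _ => ?_
    linear_combination ((1 - x) / 2) ^ (k + 1) * gegenbauerCoeff_rec_succ hμ n k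
  rw [Finset.sum_sub_distrib, ← Finset.mul_sum, ← Finset.mul_sum, ← Finset.mul_sum,
    Finset.sum_sub_distrib, ← Finset.mul_sum] at h
  linear_combination h + gegenbauerCoeff_rec_zero μ n

/-- Both sides satisfy the same three-term recurrence and agree in degrees zero and one. -/
theorem gegenbauerC_joukowski {μ : ℂ} (hμ : ∀ k : ℕ, μ + 1 / 2 + k ≠ 0) {w : ℂ} (hw : w ≠ 0)
    (n : ℕ) : gegenbauerC n μ (joukowski w) = gegenbauerLaurent μ w n := by
  refine eq_of_three_term_recurrence (p := fun n => gegenbauerC n μ (joukowski w)) ?_ ?_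
    (gegenbauerC_rec hμ _) (gegenbauerLaurent_rec μ hw) n
  · simp [gegenbauerLaurent_zero, gegenbauerC_eq_sum μ _ zero_lt_one, gegenbauerCoeff,
      invFactorialSub, risingFactorial]
  · have := hμ 0
    have r1 : ∀ a, risingFactorial a 1 = a := fun a => by simp [risingFactorial]
    have r2 : ∀ a, risingFactorial a (1 + 1) = a * (a + 1) := fun a => by
      rw [risingFactorial_succ, r1, Nat.cast_one]
    rw [gegenbauerLaurent_one μ w hw, gegenbauerC_eq_sum μ _ (show 1 < 1 + 1 by omega),
      Finset.sum_range_succ, Finset.sum_range_one]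
    simp only [gegenbauerCoeff, invFactorialSub, r1, r2, risingFactorial_zero]
    simp at this ⊢
    obtain ⟨D, rfl⟩ : ∃ D, μ = D - 2⁻¹ := ⟨μ + 2⁻¹, by ring⟩
    have h2 : D ≠ 0 := fun h => this (by rw [h]; ring)
    rw [sub_add_cancel]
    field_simp
    ring

/-! ### The connection formula between orders `ν` and `μ`. -/

/-- The coefficients in the connection formula between Gegenbauer polynomials of orders `ν`
and `μ`, up to a factor. -/
def connectionCoeff (ν μ : ℂ) (s k : ℕ) : ℂ :=
  risingFactorial (ν - μ) k * risingFactorial ν s / (k.factorial * risingFactorial μ (s + 1))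

/-- The coefficient of `g i` in the order-`ν` recurrence at `m = i + 2 * k`, once the order-`μ`
recurrence has removed the factor `x`. -/
theorem connectionCoeff_rec (ν : ℂ) {μ : ℂ} (hμ : ∀ k : ℕ, μ + k ≠ 0) (i k : ℕ) :
    ((i : ℂ) + 2 * k + 2) * connectionCoeff ν μ (i + k + 1) (k + 1) * (i + μ) =
      (i + 2 * k + 1 + ν) * (connectionCoeff ν μ (i + k) (k + 1) * i +
        connectionCoeff ν μ (i + k + 1) k * (i + 2 * μ)) -
      (i + 2 * k + 2 * ν) * connectionCoeff ν μ (i + k) k * (i + μ) := by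
  simp only [connectionCoeff, risingFactorial_succ, Nat.factorial_succ]
  have h1 := hμ (i + k)
  have h2 := hμ (i + k + 1)
  have h3 := risingFactorial_ne_zero hμ (i + k)
  have h4 := Nat.factorial_ne_zero k
  have h5 : (k : ℂ) + 1 ≠ 0 := by exact_mod_cast Nat.succ_ne_zero k
  push_cast at h1 h2 ⊢
  generalize risingFactorial μ (i + k) = H at h3 ⊢
  generalize risingFactorial ν (i + k) = S
  generalize risingFactorial (ν - μ) k = E
  obtain ⟨D, rfl⟩ : ∃ D, μ = D - (i + k) := ⟨μ + (i + k), by ring⟩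
  have h6 : D ≠ 0 := fun h => h1 (by rw [h]; ring)
  have h7 : D + 1 ≠ 0 := fun h => h2 (by linear_combination h)
  rw [show D - (i + k) + ((i : ℂ) + k) = D by ring,
    show D - (i + k) + ((i : ℂ) + k + 1) = D + 1 by ring]
  field_simp
  ring

theorem connectionCoeff_rec_zero (ν : ℂ) {μ : ℂ} (hμ : ∀ k : ℕ, μ + k ≠ 0) (m : ℕ) :
    connectionCoeff ν μ (m + 2) 0 * (m + 2 + μ) =
      (m + 1 + ν) * connectionCoeff ν μ (m + 1) 0 := by
  simp only [connectionCoeff, risingFactorial_succ, risingFactorial_zero]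
  have h1 := hμ m
  have h2 := hμ (m + 1)
  have h2' := hμ (m + 1 + 1)
  have h3 := risingFactorial_ne_zero hμ m
  push_cast at h2 h2' ⊢
  rw [show μ + ((m : ℂ) + 1 + 1) = μ + (m + 2) by ring] at h2'
  rw [show (m : ℂ) + 2 + μ = μ + (m + 2) by ring]
  generalize μ + ((m : ℂ) + 2) = D at h2' ⊢
  field_simp
  ring

/-- Extension of a sequence by zero to the negative integers. -/
def extendZero (g : ℕ → ℂ) (i : ℤ) : ℂ := if 0 ≤ i then g i.toNat else 0

theorem extendZero_natCast (g : ℕ → ℂ) (n : ℕ) : extendZero g n = g n := by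
  simp [extendZero]

theorem extendZero_of_neg (g : ℕ → ℂ) {i : ℤ} (hi : i < 0) : extendZero g i = 0 := by
  simp [extendZero, hi]

/-- The recurrence survives extension by zero: at `i = -1` both coefficients that could matter
vanish, and at `i = 0` it is the value of `g 1`. -/
theorem extendZero_rec {μ x : ℂ} {g : ℕ → ℂ} (h0 : g 0 = 1) (h1 : g 1 = 2 * μ * x)
    (hg : ∀ n : ℕ, ((n : ℂ) + 2) * g (n + 2) =
      2 * (n + 1 + μ) * x * g (n + 1) - (n + 2 * μ) * g n) (i : ℤ) :
    2 * x * ((i + μ) * extendZero g i) =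
      (i + 1) * extendZero g (i + 1) + (i - 1 + 2 * μ) * extendZero g (i - 1) := by
  rcases lt_trichotomy i (-1) with hi | rfl | hi
  · rw [extendZero_of_neg g (by omega), extendZero_of_neg g (by omega),
      extendZero_of_neg g (by omega)]
    ring
  · simp [extendZero]
  · lift i to ℕ using by omega
    cases i with
    | zero =>
      rw [extendZero_of_neg g (show ((0 : ℕ) : ℤ) - 1 < 0 by omega),
        show ((0 : ℕ) : ℤ) + 1 = ((1 : ℕ) : ℤ) by norm_num, extendZero_natCast, extendZero_natCast,
        h0, h1]
      push_cast
      ring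
    | succ n =>
      rw [show ((n + 1 : ℕ) : ℤ) + 1 = ((n + 2 : ℕ) : ℤ) by push_cast; ring,
        show ((n + 1 : ℕ) : ℤ) - 1 = (n : ℤ) by push_cast; ring, extendZero_natCast,
        extendZero_natCast, extendZero_natCast]
      have := hg n
      push_cast
      linear_combination -this

/-- The terms of the connection formula between Gegenbauer polynomials of orders `ν` and `μ`. -/
def connectionTerm (ν μ : ℂ) (g : ℕ → ℂ) (m k : ℕ) : ℂ :=
  connectionCoeff ν μ (m - k) k * (m - 2 * k + μ) * extendZero g (m - 2 * k)

theorem connectionTerm_eq_zero (ν μ : ℂ) (g : ℕ → ℂ) {m k : ℕ} (h : m < 2 * k) :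
    connectionTerm ν μ g m k = 0 := by
  rw [connectionTerm, extendZero_of_neg g (by omega), mul_zero]

theorem sum_connectionTerm (ν μ : ℂ) (g : ℕ → ℂ) {m N : ℕ} (h : m + 1 ≤ N) :
    ∑ k ∈ Finset.range N, connectionTerm ν μ g m k =
      ∑ k ∈ Finset.range (m + 1), connectionTerm ν μ g m k := by
  symm
  refine Finset.sum_subset (by simpa using h) fun k _ hk => connectionTerm_eq_zero ν μ g ?_
  rw [Finset.mem_range] at hk
  omega

/-- Multiplication by `x` moves each `g i` to its two neighbours. Regrouping by index reduces the
claim to an identity between the coefficients. -/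
theorem connection_rec (ν : ℂ) {μ x : ℂ} (hμ : ∀ k : ℕ, μ + k ≠ 0) {g : ℕ → ℂ}
    (h0 : g 0 = 1) (h1 : g 1 = 2 * μ * x)
    (hg : ∀ n : ℕ, ((n : ℂ) + 2) * g (n + 2) =
      2 * (n + 1 + μ) * x * g (n + 1) - (n + 2 * μ) * g n) (m : ℕ) :
    ((m : ℂ) + 2) * ∑ k ∈ Finset.range (m + 2 + 1), connectionTerm ν μ g (m + 2) k =
      2 * (m + 1 + ν) * x * ∑ k ∈ Finset.range (m + 1 + 1), connectionTerm ν μ g (m + 1) k -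
        (m + 2 * ν) * ∑ k ∈ Finset.range (m + 1), connectionTerm ν μ g m k := by
  let A : ℕ → ℂ := fun k => connectionCoeff ν μ (m + 1 - k) k * (m + 2 - 2 * k) *
    extendZero g (m + 2 - 2 * k)
  let B : ℕ → ℂ := fun k => connectionCoeff ν μ (m + 1 - k) k * (m - 2 * k + 2 * μ) *
    extendZero g (m - 2 * k)
  have hmid : ∀ k, 2 * x * connectionTerm ν μ g (m + 1) k = A k + B k := by
    intro k
    have := extendZero_rec h0 h1 hg (m + 1 - 2 * k)
    rw [show (m : ℤ) + 1 - 2 * k + 1 = m + 2 - 2 * k by ring,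
      show (m : ℤ) + 1 - 2 * k - 1 = m - 2 * k by ring] at this
    simp only [connectionTerm, A, B]
    push_cast at this ⊢
    linear_combination connectionCoeff ν μ (m + 1 - k) k * this
  -- The upper neighbour in term `k + 1` has the same index as the lower neighbour in term `k`, so
  -- `A` is shifted by one; its new last term has negative index and vanishes.
  have hA : ∑ k ∈ Finset.range (m + 2), A k = A 0 + ∑ k ∈ Finset.range (m + 2), A (k + 1) := by
    have h := Finset.sum_range_succ A (m + 2)
    rw [Finset.sum_range_succ'] at h
    have hz : A (m + 2) = 0 := by
      simp only [A]
      rw [extendZero_of_neg g (by push_cast; omega), mul_zero]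
    rw [hz] at h
    linear_combination -h
  have hstep : ∀ k ∈ Finset.range (m + 2), (m + 2) * connectionTerm ν μ g (m + 2) (k + 1) =
      (m + 1 + ν) * (A (k + 1) + B k) - (m + 2 * ν) * connectionTerm ν μ g m k := by
    intro k _
    simp only [connectionTerm, A, B]
    have e1 : ((m + 2 : ℕ) : ℤ) - 2 * ((k + 1 : ℕ) : ℤ) = m - 2 * k := by push_cast; ring
    have e2 : (m : ℤ) + 2 - 2 * ((k + 1 : ℕ) : ℤ) = m - 2 * k := by push_cast; ring
    rw [e1, e2]
    by_cases hk : m < 2 * k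
    · rw [extendZero_of_neg g (by omega)]
      ring
    · obtain ⟨i, rfl⟩ := Nat.exists_eq_add_of_le (not_lt.mp hk)
      have h := connectionCoeff_rec ν hμ i k
      rw [show 2 * k + i + 2 - (k + 1) = i + k + 1 by omega,
        show 2 * k + i + 1 - (k + 1) = i + k by omega,
        show 2 * k + i + 1 - k = i + k + 1 by omega, show 2 * k + i - k = i + k by omega]
      push_cast
      linear_combination extendZero g (2 * k + i - 2 * k) * h
  have hzero : (m + 2) * connectionTerm ν μ g (m + 2) 0 = (m + 1 + ν) * A 0 := by
    have h := connectionCoeff_rec_zero ν hμ m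
    simp only [connectionTerm, A, Nat.sub_zero]
    push_cast
    linear_combination (m + 2) * extendZero g (m + 2 - 0) * h
  have hsum := Finset.sum_congr rfl hstep
  rw [← Finset.mul_sum, Finset.sum_sub_distrib, ← Finset.mul_sum, ← Finset.mul_sum,
    Finset.sum_add_distrib] at hsum
  have hmid' : 2 * x * ∑ k ∈ Finset.range (m + 2), connectionTerm ν μ g (m + 1) k =
      ∑ k ∈ Finset.range (m + 2), A k + ∑ k ∈ Finset.range (m + 2), B k := by
    rw [Finset.mul_sum, ← Finset.sum_add_distrib]
    exact Finset.sum_congr rfl fun k _ => hmid k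
  rw [Finset.sum_range_succ', ← sum_connectionTerm ν μ g (show m + 1 ≤ m + 2 by omega)]
  linear_combination hsum + hzero - (m + 1 + ν) * hmid' + (m + 1 + ν) * (-hA)

/-- The connection formula between Gegenbauer polynomials of different orders. -/
theorem gegenbauerLaurent_connection (ν : ℂ) {μ : ℂ} (hμ : ∀ k : ℕ, μ + k ≠ 0) {w : ℂ}
    (hw : w ≠ 0) (m : ℕ) :
    gegenbauerLaurent ν w m =
      ∑ k ∈ Finset.range (m + 1), connectionTerm ν μ (gegenbauerLaurent μ w) m k := by
  have h0 := gegenbauerLaurent_zero μ w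
  have h1 := gegenbauerLaurent_one μ w hw
  refine eq_of_three_term_recurrence (q := fun m => ∑ k ∈ Finset.range (m + 1),
    connectionTerm ν μ (gegenbauerLaurent μ w) m k) ?_ ?_ (gegenbauerLaurent_rec ν hw)
    (connection_rec ν hμ h0 h1 (gegenbauerLaurent_rec μ hw)) m
  · have := hμ 0
    simp [connectionTerm, connectionCoeff, extendZero, h0, gegenbauerLaurent_zero,
      risingFactorial] at this ⊢
    field_simp
  · have h2 := hμ 0
    have h3 := hμ 1
    rw [Finset.sum_range_succ, connectionTerm_eq_zero ν μ _ (by omega), Finset.sum_range_one,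
      gegenbauerLaurent_one ν w hw]
    simp [connectionTerm, connectionCoeff, extendZero, h1, risingFactorial_succ,
      risingFactorial_zero] at h2 h3 ⊢
    field_simp
    ring

/-! ### Convergence and rearrangement of the expansion. -/

theorem subexponential_natCast_add_one : Subexponential fun n => (n : ℂ) + 1 := by
  have h := subexponential_risingFactorial_div 2 1
  convert! h using 2 with n
  rw [risingFactorial_one]
  have := Nat.factorial_ne_zero n
  rw [eq_div_iff (by exact_mod_cast this)]
  induction n with
  | zero => simp [risingFactorial_zero]
  | succ n ih =>
    rw [risingFactorial_succ, ← ih (Nat.factorial_ne_zero n), Nat.factorial_succ]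
    push_cast
    ring

/-- The factor `w ^ n` cancels all negative powers of `w`, leaving `n + 1` terms of subexponential
size. -/
theorem subexponential_gegenbauerLaurent (ν : ℂ) {w : ℂ} (hw : w ≠ 0) (hw1 : ‖w‖ ≤ 1) :
    Subexponential fun n => gegenbauerLaurent ν w n * w ^ n := by
  have key : ∀ s : ℝ, 1 < s → ∃ K : ℝ, 0 < K ∧
      ∀ n, ‖gegenbauerLaurent ν w n * w ^ n‖ ≤ (n + 1) * (K * s ^ n) := by
    intro s hs
    obtain ⟨K, hK, h⟩ := subexponential_risingFactorial_div_factorial ν s hs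
    refine ⟨K * K, by positivity, fun n => ?_⟩
    rw [gegenbauerLaurent, Finset.sum_mul]
    refine (norm_sum_le _ _).trans ?_
    refine (Finset.sum_le_card_nsmul _ _ (K * K * s ^ n) fun p hp => ?_).trans ?_
    · obtain ⟨j, l⟩ := p
      obtain rfl : j + l = n := Finset.HasAntidiagonal.mem_antidiagonal.mp hp
      have e : risingFactorial ν j / j.factorial * w ^ j *
          (risingFactorial ν l / l.factorial * w⁻¹ ^ l) * w ^ (j + l) =
          (risingFactorial ν j / j.factorial) * (risingFactorial ν l / l.factorial) *
            w ^ (2 * j) := by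
        rw [pow_add, inv_pow, two_mul, pow_add]
        field_simp
      simp only [e]
      rw [norm_mul, norm_mul, norm_pow]
      calc _ ≤ (K * s ^ j) * (K * s ^ l) * 1 := by
            gcongr
            · exact h j
            · exact h l
            · exact pow_le_one₀ (norm_nonneg _) hw1
        _ = _ := by ring
    · rw [Finset.Nat.card_antidiagonal, nsmul_eq_mul]
      push_cast
      exact le_rfl
  intro s hs
  have hs' : 1 < √s := by
    rw [Real.lt_sqrt (by norm_num)]
    simpa using hs
  obtain ⟨K, hK, h⟩ := key _ hs'
  obtain ⟨M, hM, h'⟩ := subexponential_natCast_add_one _ hs'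
  refine ⟨M * K, by positivity, fun n => (h n).trans ?_⟩
  have h2 : (n : ℝ) + 1 ≤ M * √s ^ n := by
    have : ‖(n : ℂ) + 1‖ ≤ M * √s ^ n := h' n
    rwa [← Nat.cast_succ, norm_natCast, Nat.cast_succ] at this
  calc _ ≤ (M * √s ^ n) * (K * √s ^ n) := by gcongr
    _ = M * K * (√s ^ 2) ^ n := by ring
    _ = M * K * s ^ n := by rw [Real.sq_sqrt (by linarith)]

theorem hasSum_gegenbauerLaurent (ν : ℂ) {w ρ : ℂ} (h1 : ‖ρ * w‖ < 1) (h2 : ‖ρ * w⁻¹‖ < 1) :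
    HasSum (fun n => gegenbauerLaurent ν w n * ρ ^ n)
      ((1 - ρ * w) ^ (-ν) * (1 - ρ * w⁻¹) ^ (-ν)) := by
  have n1 := (subexponential_risingFactorial_div_factorial ν).summable_norm h1
  have n2 := (subexponential_risingFactorial_div_factorial ν).summable_norm h2
  have hs := summable_mul_of_summable_norm n1 n2
  have h' := (hasSum_binomial ν h1).mul (hasSum_binomial ν h2) hs
  have h := h'.sum_antidiagonal
  have e : ∀ n, gegenbauerLaurent ν w n * ρ ^ n =
      ∑ p ∈ Finset.HasAntidiagonal.antidiagonal n,
        (risingFactorial ν p.1 / p.1.factorial * (ρ * w) ^ p.1) *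
          (risingFactorial ν p.2 / p.2.factorial * (ρ * w⁻¹) ^ p.2) := by
    intro n
    rw [gegenbauerLaurent, Finset.sum_mul]
    refine Finset.sum_congr rfl fun p hp => ?_
    rw [← Finset.HasAntidiagonal.mem_antidiagonal.mp hp, pow_add, mul_pow, mul_pow]
    ring
  simp only [e]
  exact h

theorem summable_connection (ν μ : ℂ) (hμ : ∀ k : ℕ, μ + k ≠ 0) {w ρ : ℂ} (hw : w ≠ 0)
    (hw1 : ‖w‖ ≤ 1) (hρ : ‖ρ‖ < ‖w‖) :
    Summable fun p : ℕ × ℕ => connectionCoeff ν μ (p.1 + p.2) p.2 * (p.1 + μ) *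
      gegenbauerLaurent μ w p.1 * ρ ^ (p.1 + 2 * p.2) := by
  have hwpos : 0 < ‖w‖ := norm_pos_iff.mpr hw
  have hq : ‖ρ‖ / ‖w‖ < 1 := (div_lt_one hwpos).mpr hρ
  have hρq : ‖ρ‖ ≤ ‖ρ‖ / ‖w‖ := by
    rw [le_div_iff₀ hwpos]
    exact mul_le_of_le_one_right (norm_nonneg _) hw1
  have hρ1 : ‖ρ‖ < 1 := hρq.trans_lt hq
  obtain ⟨s', hs', hsq'⟩ := exists_one_lt_mul_lt (by positivity) hq
  -- The three growth bounds `s ^ n`, `s ^ k` and `s ^ (n + k)` combine to `(s * s) ^ (n + k)`.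
  obtain ⟨s, hs, hss⟩ : ∃ s : ℝ, 1 < s ∧ s * s = s' := by
    refine ⟨√s', ?_, Real.mul_self_sqrt (by linarith)⟩
    rw [Real.lt_sqrt (by norm_num)]
    simpa using hs'
  have hμ0 : μ ≠ 0 := by simpa using hμ 0
  have hu := (subexponential_risingFactorial_div (μ + 1) μ).mul
    (subexponential_gegenbauerLaurent μ hw hw1)
  obtain ⟨K₁, hK₁, h1⟩ := hu s hs
  obtain ⟨K₂, hK₂, h2⟩ := subexponential_risingFactorial_div_factorial (ν - μ) s hs
  obtain ⟨K₃, hK₃, h3⟩ := subexponential_risingFactorial_div ν (μ + 1) s hs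
  have hg : Summable fun p : ℕ × ℕ => K₁ * K₂ * K₃ *
      ((s' * (‖ρ‖ / ‖w‖)) ^ p.1 * (s' * (‖ρ‖ / ‖w‖)) ^ p.2) := by
    refine Summable.mul_left _ ?_
    have := summable_geometric_of_lt_one (r := s' * (‖ρ‖ / ‖w‖)) (by positivity) hsq'
    exact this.mul_of_nonneg this (fun _ => by positivity) (fun _ => by positivity)
  refine Summable.of_norm_bounded hg fun ⟨n, k⟩ => ?_
  -- Here `ρ ^ n` is split as `w ^ n * (ρ / w) ^ n`, and `n + μ` is written as `μ (μ+1)_n / (μ)_n`,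
  -- so that every factor has a known growth bound.
  have e : connectionCoeff ν μ (n + k) k * (n + μ) * gegenbauerLaurent μ w n * ρ ^ (n + 2 * k) =
      (risingFactorial (μ + 1) n / risingFactorial μ n * (gegenbauerLaurent μ w n * w ^ n)) *
      (risingFactorial (ν - μ) k / k.factorial) *
      (risingFactorial ν (n + k) / risingFactorial (μ + 1) (n + k)) *
      ((ρ / w) ^ n * ρ ^ (2 * k)) := by
    have i1 := risingFactorial_succ' μ n
    rw [risingFactorial_succ] at i1
    have hn := risingFactorial_ne_zero hμ n
    have i2 : risingFactorial (μ + 1) n / risingFactorial μ n = (n + μ) / μ := by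
      rw [div_eq_div_iff hn hμ0]
      linear_combination -i1
    rw [i2, connectionCoeff, risingFactorial_succ' μ (n + k), div_pow, pow_add]
    field_simp
  have e3 : ‖ρ‖ ^ (2 * k) ≤ (‖ρ‖ / ‖w‖) ^ k := by
    rw [pow_mul]
    gcongr
    nlinarith [norm_nonneg ρ]
  simp only [e]
  rw [norm_mul, norm_mul, norm_mul, norm_mul ((ρ / w) ^ n), norm_pow, norm_pow, norm_div ρ w]
  calc _ ≤ (K₁ * s ^ n) * (K₂ * s ^ k) * (K₃ * s ^ (n + k)) *
        ((‖ρ‖ / ‖w‖) ^ n * (‖ρ‖ / ‖w‖) ^ k) := by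
        gcongr
        · exact h1 n
        · exact h2 k
        · exact h3 (n + k)
    _ = K₁ * K₂ * K₃ * (((s * s) * (‖ρ‖ / ‖w‖)) ^ n * ((s * s) * (‖ρ‖ / ‖w‖)) ^ k) := by ring
    _ = _ := by rw [hss]

/-- The expansion of `(1 + ρ² - 2 ρ x) ^ (-ν)` in Gegenbauer polynomials of order `μ`. -/
theorem hasSum_gegenbauerLaurent_expansion (ν : ℂ) {μ : ℂ} (hμ : ∀ k : ℕ, μ + k ≠ 0) {w ρ : ℂ}
    (hw : w ≠ 0) (hw1 : ‖w‖ ≤ 1) (hρ : ‖ρ‖ < ‖w‖) :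
    HasSum (fun n : ℕ => risingFactorial ν n / risingFactorial μ (n + 1) * ((n + μ) * ρ ^ n *
      ordinaryHypergeometric (n + ν) (ν - μ) (n + μ + 1) (ρ ^ 2)) * gegenbauerLaurent μ w n)
      ((1 - ρ * w) ^ (-ν) * (1 - ρ * w⁻¹) ^ (-ν)) := by
  have hwpos : 0 < ‖w‖ := norm_pos_iff.mpr hw
  have hsum := (summable_connection ν μ hμ hw hw1 hρ).hasSum
  set S := ∑' p : ℕ × ℕ, connectionCoeff ν μ (p.1 + p.2) p.2 * (p.1 + μ) *
      gegenbauerLaurent μ w p.1 * ρ ^ (p.1 + 2 * p.2)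
  have hρ1 : ‖ρ‖ < 1 := hρ.trans_le hw1
  have hρw : ‖ρ * w‖ < 1 := by
    rw [norm_mul]
    nlinarith [norm_nonneg ρ]
  have hρw' : ‖ρ * w⁻¹‖ < 1 := by
    rwa [← div_eq_mul_inv, norm_div, div_lt_one hwpos]
  have hS : S = (1 - ρ * w) ^ (-ν) * (1 - ρ * w⁻¹) ^ (-ν) := by
    -- Reindexing by `m = n + 2 * k`: the pairs missed by `e` have `m < 2 * k`, where the term is
    -- zero.
    let F : ℕ × ℕ → ℂ := fun p => connectionTerm ν μ (gegenbauerLaurent μ w) p.1 p.2 * ρ ^ p.1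
    let e : ℕ × ℕ → ℕ × ℕ := fun p => (p.1 + 2 * p.2, p.2)
    have he : Function.Injective e := by
      rintro ⟨a, b⟩ ⟨c, d⟩ h
      simp only [e, Prod.mk.injEq] at h ⊢
      omega
    have hF : HasSum F S := by
      rw [← he.hasSum_iff]
      · convert! hsum using 2 with p
        obtain ⟨n, k⟩ := p
        simp only [F, e, Function.comp, connectionTerm]
        rw [show n + 2 * k - k = n + k by omega,
          show ((n + 2 * k : ℕ) : ℤ) - 2 * k = n by push_cast; ring, extendZero_natCast]
        push_cast
        ring
      · rintro ⟨m, k⟩ h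
        have : m < 2 * k := by
          by_contra hc
          exact h ⟨(m - 2 * k, k), by simp only [e, Prod.mk.injEq, and_true]; omega⟩
        simp only [F]
        rw [connectionTerm_eq_zero _ _ _ this, zero_mul]
    refine (hF.prod_fiberwise (g := fun m => gegenbauerLaurent ν w m * ρ ^ m) fun m => ?_).unique
      (hasSum_gegenbauerLaurent ν hρw hρw')
    rw [gegenbauerLaurent_connection ν hμ hw, Finset.sum_mul]
    refine hasSum_sum_of_ne_finset_zero fun k hk => ?_
    rw [Finset.mem_range] at hk
    simp only [F]
    rw [connectionTerm_eq_zero _ _ _ (by omega), zero_mul]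
  rw [← hS]
  refine hsum.prod_fiberwise fun n => ?_
  -- Splitting `(ν)_(n+k)` and `(μ)_(n+1+k)` after `n` and `n + 1` factors leaves hypergeometric
  -- coefficients in `k`.
  have h := (hasSum_ordinaryHypergeometric (n + ν) (ν - μ) (n + μ + 1)
    (norm_sq_lt_one hρ1)).mul_left
    (risingFactorial ν n / risingFactorial μ (n + 1) * ((n + μ) * ρ ^ n) * gegenbauerLaurent μ w n)
  convert! h using 1
  · ext k
    simp only [hypergeometricTerm, connectionCoeff]
    rw [show n + k + 1 = n + 1 + k by ring, risingFactorial_add, risingFactorial_add,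
      add_comm (n : ℂ) ν, show μ + ((n + 1 : ℕ) : ℂ) = n + μ + 1 by push_cast; ring, pow_add,
      pow_mul, mul_comm (k.factorial : ℂ), mul_div_assoc, mul_assoc (risingFactorial μ (n + 1)),
      ← div_div]
    ring
  · ring

/-! ### Confocal ellipses and the branch of the power. -/

/-- Since `joukowski w ∓ 1 = (1 ∓ w)² / (2w)`, this is the parallelogram law; circles about the
origin go to confocal ellipses. -/
theorem norm_joukowski_sub_one_add_norm_joukowski_add_one {w : ℂ} (hw : w ≠ 0) :
    ‖joukowski w - 1‖ + ‖joukowski w + 1‖ = (1 + ‖w‖ ^ 2) / ‖w‖ := by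
  have hpos : 0 < ‖w‖ := norm_pos_iff.mpr hw
  have e1 : joukowski w - 1 = (1 - w) ^ 2 / (2 * w) := by
    unfold joukowski
    field_simp
    ring
  have e2 : joukowski w + 1 = (1 + w) ^ 2 / (2 * w) := by
    unfold joukowski
    field_simp
    ring
  have h := parallelogram_law_with_norm ℝ (1 : ℂ) w
  rw [norm_one] at h
  rw [e1, e2, norm_div, norm_div, norm_pow, norm_pow, norm_mul, norm_ofNat]
  field_simp
  linear_combination h

/-- The focal sum is `r + 1/r` with `r` the norm, which decreases on `(0, 1]`. -/
theorem norm_lt_of_mem_focalEllipseInterior {R : ℝ} {ρ w : ℂ} (hρ : ρ ≠ 0) (hρ1 : ‖ρ‖ < 1)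
    (hw : w ≠ 0) (hz : joukowski ρ ∈ focalEllipse R)
    (hx : joukowski w ∈ focalEllipseInterior R) : ‖ρ‖ < ‖w‖ := by
  have hz' : ‖joukowski ρ - 1‖ + ‖joukowski ρ + 1‖ = R := hz
  have hx' : ‖joukowski w - 1‖ + ‖joukowski w + 1‖ < R := hx
  have h1 : 0 < ‖ρ‖ := norm_pos_iff.mpr hρ
  have h2 : 0 < ‖w‖ := norm_pos_iff.mpr hw
  rw [← hz', norm_joukowski_sub_one_add_norm_joukowski_add_one hρ,
    norm_joukowski_sub_one_add_norm_joukowski_add_one hw, div_lt_div_iff₀ h2 h1] at hx'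
  by_contra hc
  rw [not_lt] at hc
  have h3 : ‖ρ‖ * ‖w‖ ≤ 1 := by nlinarith
  nlinarith [mul_nonneg (sub_nonneg.mpr hc) (sub_nonneg.mpr h3)]

theorem ofReal_mul_mem_focalEllipseInterior {R t : ℝ} (ht : t ∈ Set.Icc (0 : ℝ) 1) {x : ℂ}
    (hx : x ∈ focalEllipseInterior R) : t * x ∈ focalEllipseInterior R := by
  have hx' : ‖x - 1‖ + ‖x + 1‖ < R := hx
  have e1 : t * x - 1 = (((1 + t) / 2 : ℝ) : ℂ) * (x - 1) - (((1 - t) / 2 : ℝ) : ℂ) * (x + 1) := by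
    push_cast
    ring
  have e2 : t * x + 1 = (((1 + t) / 2 : ℝ) : ℂ) * (x + 1) - (((1 - t) / 2 : ℝ) : ℂ) * (x - 1) := by
    push_cast
    ring
  have hs : ∀ a b : ℂ, ‖(((1 + t) / 2 : ℝ) : ℂ) * a - (((1 - t) / 2 : ℝ) : ℂ) * b‖ ≤
      (1 + t) / 2 * ‖a‖ + (1 - t) / 2 * ‖b‖ := by
    intro a b
    refine (norm_sub_le _ _).trans (le_of_eq ?_)
    rw [norm_mul, norm_mul, norm_real, norm_real, Real.norm_of_nonneg (by linarith [ht.1]),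
      Real.norm_of_nonneg (by linarith [ht.2])]
  have h1 := hs (x - 1) (x + 1)
  have h2 := hs (x + 1) (x - 1)
  rw [← e1] at h1
  rw [← e2] at h2
  change ‖t * x - 1‖ + ‖t * x + 1‖ < R
  linarith

/-- Along the segment, `log (a * (1 - t * b)) - log (1 - t * b)` has derivative zero, and at `t = 0`
it equals `log a`. No estimate of arguments is needed. -/
theorem log_mul_one_sub_of_segment {a b : ℂ}
    (h1 : ∀ t ∈ Set.Icc (0 : ℝ) 1, a * (1 - t * b) ∈ slitPlane)
    (h2 : ∀ t ∈ Set.Icc (0 : ℝ) 1, 1 - t * b ∈ slitPlane) :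
    log (a * (1 - b)) = log a + log (1 - b) := by
  have ha : a ≠ 0 := by
    have := slitPlane_ne_zero (h1 0 (by simp))
    exact left_ne_zero_of_mul this
  have hderiv : ∀ t ∈ Set.Icc (0 : ℝ) 1,
      HasDerivAt (fun t : ℝ => log (a * (1 - t * b)) - log (1 - t * b)) 0 t := by
    intro t ht
    have d0 : HasDerivAt (fun t : ℝ => 1 - (t : ℂ) * b) (-b) t := by
      simpa using ((hasDerivAt_id t).ofReal_comp.mul_const b).const_sub 1
    have d1 := ((d0.const_mul a).clog_real (h1 t ht)).sub (d0.clog_real (h2 t ht))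
    convert! d1 using 1
    have := slitPlane_ne_zero (h2 t ht)
    field_simp
    ring
  have hconst := constant_of_derivWithin_zero (a := (0 : ℝ)) (b := 1)
    (f := fun t : ℝ => log (a * (1 - t * b)) - log (1 - t * b))
    (fun t ht => (hderiv t ht).differentiableAt.differentiableWithinAt)
    (fun t ht => (hderiv t ⟨ht.1, ht.2.le⟩).hasDerivWithinAt.derivWithin
      (uniqueDiffOn_Icc zero_lt_one t ⟨ht.1, ht.2.le⟩)) 1 (by simp)
  simp only [ofReal_one, one_mul, ofReal_zero, zero_mul, sub_zero, mul_one, log_one] at hconst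
  linear_combination hconst

theorem one_add_sq_sub_eq {ρ w : ℂ} (hw : w ≠ 0) :
    1 + ρ ^ 2 - 2 * ρ * joukowski w = (1 - ρ * w) * (1 - ρ * w⁻¹) := by
  unfold joukowski
  field_simp
  ring

theorem one_add_sq_sub_mem_slitPlane {ρ w : ℂ} (hw : w ≠ 0) (h1 : ‖ρ * w‖ < 1)
    (h2 : ‖ρ * w⁻¹‖ < 1) : 1 + ρ ^ 2 - 2 * ρ * joukowski w ∈ slitPlane := by
  rw [one_add_sq_sub_eq hw]
  exact mul_mem_slitPlane_of_re_pos (re_one_sub_pos h1) (re_one_sub_pos h2)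

theorem one_add_sq_sub_cpow {ρ w : ℂ} (hw : w ≠ 0) (h1 : ‖ρ * w‖ < 1) (h2 : ‖ρ * w⁻¹‖ < 1)
    (ν : ℂ) : (1 - ρ * w) ^ (-ν) * (1 - ρ * w⁻¹) ^ (-ν) =
      1 / (1 + ρ ^ 2 - 2 * ρ * joukowski w) ^ ν := by
  have n0 := slitPlane_ne_zero (one_add_sq_sub_mem_slitPlane hw h1 h2)
  have n1 : 1 - ρ * w ≠ 0 := fun h => by
    have := re_one_sub_pos h1
    simp [h] at this
  have n2 : 1 - ρ * w⁻¹ ≠ 0 := fun h => by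
    have := re_one_sub_pos h2
    simp [h] at this
  rw [one_div, ← cpow_neg, cpow_def_of_ne_zero n0, cpow_def_of_ne_zero n1, cpow_def_of_ne_zero n2,
    one_add_sq_sub_eq hw, log_mul_of_re_pos (re_one_sub_pos h1) (re_one_sub_pos h2), ← exp_add]
  congr 1
  ring

theorem norm_mul_lt_one_of_norm_lt {ρ w : ℂ} (hw : w ≠ 0) (hw1 : ‖w‖ ≤ 1) (h : ‖ρ‖ < ‖w‖) :
    ‖ρ * w‖ < 1 ∧ ‖ρ * w⁻¹‖ < 1 := by
  constructor
  · rw [norm_mul]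
    nlinarith [norm_nonneg ρ]
  · rwa [← div_eq_mul_inv, norm_div, div_lt_one (norm_pos_iff.mpr hw)]

theorem one_add_sq_sub_mem_slitPlane_of_mem_focalEllipseInterior {R : ℝ} {ρ x : ℂ} (hρ : ρ ≠ 0)
    (hρ1 : ‖ρ‖ < 1) (hz : joukowski ρ ∈ focalEllipse R) (hx : x ∈ focalEllipseInterior R) :
    1 + ρ ^ 2 - 2 * ρ * x ∈ slitPlane := by
  obtain ⟨w, hw, hw1, rfl⟩ := exists_eq_joukowski x
  have h := norm_mul_lt_one_of_norm_lt hw hw1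
    (norm_lt_of_mem_focalEllipseInterior hρ hρ1 hw hz hx)
  exact one_add_sq_sub_mem_slitPlane hw h.1 h.2

/-- The segment from `0` to `x` stays inside the ellipse, and there neither `1 - x / z` nor `1 + ρ²
- 2ρx` meets the cut. So the logarithms add up. -/
theorem subPow_joukowski {R : ℝ} {ρ x : ℂ} (hρ : ρ ∈ slitPlane)
    (hρ1 : ‖ρ‖ < 1) (hz : joukowski ρ ∈ focalEllipse R) (hx : x ∈ focalEllipseInterior R) (ν : ℂ) :
    subPow (joukowski ρ) x ν = (1 + ρ ^ 2 - 2 * ρ * x) ^ ν / (2 * ρ) ^ ν := by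
  have h0 := slitPlane_ne_zero hρ
  have hcut := joukowski_mem_cutPlane hρ hρ1
  have hJ := cutPlane_ne_zero hcut
  have hmul := joukowski_mul h0
  have hsplit : ∀ y : ℂ, (1 + ρ ^ 2) * (1 - y / joukowski ρ) = 1 + ρ ^ 2 - 2 * ρ * y := by
    intro y
    rw [← hmul]
    field_simp
  have hlog : log (1 + ρ ^ 2 - 2 * ρ * x) = log (1 + ρ ^ 2) + log (1 - x / joukowski ρ) := by
    rw [← hsplit]
    refine log_mul_one_sub_of_segment (fun t ht => ?_) (fun t ht => ?_)
    · rw [← mul_div_assoc, hsplit]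
      exact one_add_sq_sub_mem_slitPlane_of_mem_focalEllipseInterior h0 hρ1 hz
        (ofReal_mul_mem_focalEllipseInterior ht hx)
    · rw [← mul_div_assoc]
      exact one_sub_div_mem_slitPlane hcut hz (ofReal_mul_mem_focalEllipseInterior ht hx)
  have n1 := slitPlane_ne_zero
    (one_add_sq_sub_mem_slitPlane_of_mem_focalEllipseInterior h0 hρ1 hz hx)
  have n2 := slitPlane_ne_zero (one_sub_div_mem_slitPlane hcut hz hx)
  rw [subPow, joukowski_cpow hρ hρ1, cpow_def_of_ne_zero n1, hlog, add_mul, exp_add,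
    ← cpow_def_of_ne_zero (one_add_sq_ne_zero hρ1), ← cpow_def_of_ne_zero n2]
  ring

/-! ### Normalization and the final expansions. -/

/-- The factor in front of the expansion in `ρ`. -/
def gegenbauerPrefactor (μ ν ρ : ℂ) : ℂ :=
  Gamma μ * exp (I * Real.pi * (μ - ν + 1 / 2)) /
    ((Real.sqrt Real.pi : ℂ) * Gamma ν * ρ ^ (μ + 1 / 2) * (1 - ρ ^ 2) ^ (ν - μ - 1 / 2))

theorem cpow_ne_zero_of_ne_zero {a : ℂ} (ha : a ≠ 0) (b : ℂ) : a ^ b ≠ 0 := by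
  rw [Ne, cpow_eq_zero_iff]
  exact fun h => ha h.1

theorem sqrt_pi_ne_zero : (Real.sqrt Real.pi : ℂ) ≠ 0 := by
  exact_mod_cast (Real.sqrt_pos.mpr Real.pi_pos).ne'

theorem Gamma_ne_zero_of_forall_add {a : ℂ} (ha : ∀ k : ℕ, a + k ≠ 0) : Gamma a ≠ 0 :=
  Gamma_ne_zero fun k h => ha k (by rw [h]; ring)

theorem gegenbauerPrefactor_ne_zero {μ ν ρ : ℂ} (hμ : ∀ k : ℕ, μ + k ≠ 0)
    (hν : ∀ k : ℕ, ν + k ≠ 0) (hρ : ρ ≠ 0) (hρ1 : ‖ρ‖ < 1) : gegenbauerPrefactor μ ν ρ ≠ 0 :=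
  div_ne_zero (mul_ne_zero (Gamma_ne_zero_of_forall_add hμ) (exp_ne_zero _))
    (mul_ne_zero (mul_ne_zero (mul_ne_zero sqrt_pi_ne_zero (Gamma_ne_zero_of_forall_add hν))
      (cpow_ne_zero_of_ne_zero hρ _)) (cpow_ne_zero_of_ne_zero (one_sub_sq_ne_zero hρ1) _))

/-- The prefactor removes all that does not depend on `n`; the quotient of `Gamma (n + ν)` by `Gamma
(n + μ + 1)` becomes the quotient of rising factorials. -/
theorem gegenbauerPrefactor_mul_legendreQ {μ ν ρ : ℂ} (hμ : ∀ k : ℕ, μ + k ≠ 0)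
    (hν : ∀ k : ℕ, ν + k ≠ 0) (hρ : ρ ∈ slitPlane) (hρ1 : ‖ρ‖ < 1) (n : ℕ) (c : ℂ) :
    gegenbauerPrefactor μ ν ρ *
        ((n + μ) * legendreQ (n + μ - 1 / 2) (ν - μ - 1 / 2) (joukowski ρ) * c) =
      risingFactorial ν n / risingFactorial μ (n + 1) * ((n + μ) * ρ ^ n *
        ordinaryHypergeometric (n + ν) (ν - μ) (n + μ + 1) (ρ ^ 2)) * c := by
  have h0 := slitPlane_ne_zero hρ
  have hα : ∀ k : ℕ, (n + μ - 1 / 2 : ℂ) + 3 / 2 + k ≠ 0 := fun k h => hμ (n + 1 + k) (by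
    push_cast
    linear_combination h)
  have e1 : Gamma (n + ν) = risingFactorial ν n * Gamma ν := by
    rw [add_comm, Gamma_add_nat_eq_risingFactorial_mul hν]
  have e2 : Gamma (n + μ + 1) = risingFactorial μ (n + 1) * Gamma μ := by
    rw [← Gamma_add_nat_eq_risingFactorial_mul hμ]
    congr 1
    push_cast
    ring
  have e3 : ρ ^ (n + μ + 1 / 2 : ℂ) = ρ ^ n * ρ ^ (μ + 1 / 2) := by
    rw [add_assoc, cpow_add _ _ h0, cpow_natCast]
  have e4 : exp (I * Real.pi * (μ - ν + 1 / 2)) = (exp (I * Real.pi * (ν - μ - 1 / 2)))⁻¹ := by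
    rw [← exp_neg]
    congr 1
    ring
  rw [legendreQ_joukowski hα _ hρ hρ1, legendreQNome, gegenbauerPrefactor,
    show (n + μ - 1 / 2 : ℂ) + (ν - μ - 1 / 2) + 1 = n + ν by ring,
    show (n + μ - 1 / 2 : ℂ) + 3 / 2 = n + μ + 1 by ring,
    show (n + μ - 1 / 2 : ℂ) + 1 = n + μ + 1 / 2 by ring,
    show ν - μ - 1 / 2 + 1 / 2 = ν - μ by ring, e1, e2, e3, e4]
  have n1 := sqrt_pi_ne_zero
  have n2 := Gamma_ne_zero_of_forall_add hμ
  have n3 := Gamma_ne_zero_of_forall_add hν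
  have n4 := cpow_ne_zero_of_ne_zero h0 (μ + 1 / 2)
  have n5 := cpow_ne_zero_of_ne_zero (one_sub_sq_ne_zero hρ1) (ν - μ - 1 / 2)
  have n6 := risingFactorial_ne_zero hμ (n + 1)
  have n7 := exp_ne_zero (I * Real.pi * (ν - μ - 1 / 2))
  generalize exp (I * Real.pi * (ν - μ - 1 / 2)) = X1 at n7 ⊢
  generalize (1 - ρ ^ 2) ^ (ν - μ - 1 / 2) = X2 at n5 ⊢
  generalize ρ ^ (μ + 1 / 2) = X3 at n4 ⊢
  generalize (ordinaryHypergeometric (n + ν) (ν - μ) (n + μ + 1) (ρ ^ 2) : ℂ) = X4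
  field_simp

theorem hasSum_gegenbauerC_expansion {μ ν ρ w : ℂ} (hμ : ∀ k : ℕ, μ + k ≠ 0)
    (hμ' : ∀ k : ℕ, μ + 1 / 2 + k ≠ 0) (hν : ∀ k : ℕ, ν + k ≠ 0) (hρ : ρ ∈ slitPlane)
    (hw : w ≠ 0) (hw1 : ‖w‖ ≤ 1) (h : ‖ρ‖ < ‖w‖) :
    HasSum (fun n : ℕ => gegenbauerPrefactor μ ν ρ *
        ((n + μ) * legendreQ (n + μ - 1 / 2) (ν - μ - 1 / 2) (joukowski ρ) *
          gegenbauerC n μ (joukowski w)))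
      (1 / (1 + ρ ^ 2 - 2 * ρ * joukowski w) ^ ν) := by
  have h12 := norm_mul_lt_one_of_norm_lt hw hw1 h
  have hs := hasSum_gegenbauerLaurent_expansion ν hμ hw hw1 h
  rw [one_add_sq_sub_cpow hw h12.1 h12.2] at hs
  simp only [gegenbauerPrefactor_mul_legendreQ hμ hν hρ (h.trans_le hw1),
    gegenbauerC_joukowski hμ' hw]
  exact hs

theorem summable_and_eq_mul_tsum {f : ℕ → ℂ} {a S : ℂ} (ha : a ≠ 0)
    (h : HasSum (fun n => a * f n) S) : Summable f ∧ S = a * ∑' n, f n :=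
  ⟨(summable_mul_left_iff ha).mp h.summable, by rw [← tsum_mul_left, h.tsum_eq]⟩

/-- On `[-1, 1]` the focal sum is `2`, which forces `(‖w‖ - 1)² = 0`. -/
theorem exists_norm_eq_one_eq_joukowski {x : ℝ} (hx : x ∈ Set.Icc (-1 : ℝ) 1) :
    ∃ w : ℂ, w ≠ 0 ∧ ‖w‖ = 1 ∧ (x : ℂ) = joukowski w := by
  obtain ⟨w, hw, _, h⟩ := exists_eq_joukowski x
  refine ⟨w, hw, ?_, h⟩
  have hpos : 0 < ‖w‖ := norm_pos_iff.mpr hw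
  have e := norm_joukowski_sub_one_add_norm_joukowski_add_one hw
  rw [← h, ← ofReal_one, ← ofReal_sub, ← ofReal_add, norm_real, norm_real,
    Real.norm_of_nonpos (by linarith [hx.2]), Real.norm_of_nonneg (by linarith [hx.1]),
    eq_div_iff hpos.ne'] at e
  nlinarith [sq_nonneg (‖w‖ - 1)]

/-- Because `2ρ(z - x) = 1 + ρ² - 2ρx`, the expansions in `z` and in `ρ` differ by the factor `(2ρ)
^ ν`. -/
theorem prefactor_mul_two_mul_cpow {μ ν ρ : ℂ} (hρ : ρ ∈ slitPlane) (hρ1 : ‖ρ‖ < 1) :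
    (2 : ℂ) ^ (μ + 1 / 2) * Gamma μ * exp (I * Real.pi * (μ - ν + 1 / 2)) /
        ((Real.sqrt Real.pi : ℂ) * Gamma ν *
          sqSubOnePow (joukowski ρ) ((ν - μ) / 2 - 1 / 4)) =
      (2 * ρ) ^ ν * gegenbauerPrefactor μ ν ρ := by
  have h0 := slitPlane_ne_zero hρ
  have h2ρ := slitPlane_ne_zero (two_mul_mem_slitPlane hρ)
  have hlog : log (2 * ρ) = log 2 + log ρ :=
    log_mul_of_im_mul_im_nonpos (by simp) hρ (by simp)
  have e : (2 * ρ) ^ ν = 2 ^ (μ + 1 / 2) * ρ ^ (μ + 1 / 2) * (2 * ρ) ^ (ν - μ - 1 / 2) := by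
    rw [cpow_def_of_ne_zero h2ρ, cpow_def_of_ne_zero h2ρ, cpow_def_of_ne_zero two_ne_zero,
      cpow_def_of_ne_zero h0, ← exp_add, ← exp_add, hlog]
    congr 1
    ring
  rw [sqSubOnePow_joukowski hρ hρ1, show 2 * ((ν - μ) / 2 - 1 / 4) = ν - μ - 1 / 2 by ring, e,
    gegenbauerPrefactor]
  have n4 := cpow_ne_zero_of_ne_zero h0 (μ + 1 / 2)
  have n5 := cpow_ne_zero_of_ne_zero h2ρ (ν - μ - 1 / 2)
  generalize (2 * ρ) ^ (ν - μ - 1 / 2) = X1 at n5 ⊢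
  generalize (1 - ρ ^ 2) ^ (ν - μ - 1 / 2) = X2
  generalize ρ ^ (μ + 1 / 2) = X3 at n4 ⊢
  rw [mul_div_assoc', div_div_eq_mul_div, mul_div_assoc', ← mul_div_mul_right _ _ n4]
  congr 1 <;> ring

/-- For `ν = μ` a parameter of the hypergeometric function is zero, so only its constant term
survives. -/
theorem gegenbauerPrefactor_mul_legendreQ_self {μ ρ : ℂ} (hμ : ∀ k : ℕ, μ + k ≠ 0)
    (hρ : ρ ∈ slitPlane) (hρ1 : ‖ρ‖ < 1) (n : ℕ) (c : ℂ) :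
    gegenbauerPrefactor μ μ ρ *
        ((n + μ) * legendreQ (n + μ - 1 / 2) (μ - μ - 1 / 2) (joukowski ρ) * c) = c * ρ ^ n := by
  have h1 := hμ n
  have h2 := risingFactorial_ne_zero hμ n
  have hF : (ordinaryHypergeometric (n + μ) (μ - μ) (n + μ + 1) (ρ ^ 2) : ℂ) = 1 := by
    rw [ordinaryHypergeometric_eq_tsum_hypergeometricTerm, tsum_eq_single 0]
    · simp [hypergeometricTerm, risingFactorial_zero]
    · intro k hk
      obtain ⟨k, rfl⟩ := Nat.exists_eq_succ_of_ne_zero hk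
      simp [hypergeometricTerm, risingFactorial_succ']
  rw [gegenbauerPrefactor_mul_legendreQ hμ hμ hρ hρ1, hF, risingFactorial_succ, add_comm (n : ℂ)]
  field_simp

/-- This comes directly from the Cauchy product with `‖w‖ = 1`; no power of `ρ` needs a branch, so
the whole disc is allowed. -/
theorem hasSum_gegenbauerC_mul_pow {μ ρ : ℂ} (hμ : ∀ k : ℕ, μ + 1 / 2 + k ≠ 0) (hρ1 : ‖ρ‖ < 1)
    {x : ℝ} (hx : x ∈ Set.Icc (-1 : ℝ) 1) :
    HasSum (fun n : ℕ => gegenbauerC n μ x * ρ ^ n) (1 / (1 + ρ ^ 2 - 2 * ρ * x) ^ μ) := by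
  obtain ⟨w, hw, hw1, h⟩ := exists_norm_eq_one_eq_joukowski hx
  have h12 := norm_mul_lt_one_of_norm_lt hw hw1.le (hρ1.trans_eq hw1.symm)
  rw [h, ← one_add_sq_sub_cpow hw h12.1 h12.2]
  simp only [gegenbauerC_joukowski hμ hw]
  exact hasSum_gegenbauerLaurent μ h12.1 h12.2

end

theorem theorem1 (μ : ℝ) (hμ : -1 / 2 < μ) (hμ0 : μ ≠ 0) :
    (∀ ν : ℂ, (∀ k : ℕ, ν ≠ -(k : ℂ)) →
      -- the expansion of `(z - x) ^ (-ν)`, for `x` inside the ellipse through `z`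
      (∀ (R : ℝ) (z x : ℂ), 2 < R → z ∈ cutPlane → z ∈ focalEllipse R →
        x ∈ focalEllipseInterior R →
        Summable (fun n : ℕ => ((n : ℂ) + μ) *
          legendreQ (n + μ - 1 / 2) (ν - μ - 1 / 2) z * gegenbauerC n μ x) ∧
        1 / subPow z x ν =
          (2 : ℂ) ^ ((μ : ℂ) + 1 / 2) * Complex.Gamma μ *
              Complex.exp (Complex.I * Real.pi * (μ - ν + 1 / 2)) /
            ((Real.sqrt Real.pi : ℂ) * Complex.Gamma ν *
              sqSubOnePow z ((ν - μ) / 2 - 1 / 4)) *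
          ∑' n : ℕ, ((n : ℂ) + μ) *
            legendreQ (n + μ - 1 / 2) (ν - μ - 1 / 2) z * gegenbauerC n μ x) ∧
      -- the same expansion in the variable `ρ`, where `z = (1 + ρ ^ 2) / (2 ρ)`
      (∀ (ρ : ℂ) (x : ℝ), ρ ∈ Complex.slitPlane → ‖ρ‖ < 1 → x ∈ Set.Icc (-1 : ℝ) 1 →
        Summable (fun n : ℕ => ((n : ℂ) + μ) *
          legendreQ (n + μ - 1 / 2) (ν - μ - 1 / 2) ((1 + ρ ^ 2) / (2 * ρ)) *
            gegenbauerC n μ x) ∧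
        1 / (1 + ρ ^ 2 - 2 * ρ * x) ^ ν =
          Complex.Gamma μ * Complex.exp (Complex.I * Real.pi * (μ - ν + 1 / 2)) /
            ((Real.sqrt Real.pi : ℂ) * Complex.Gamma ν * ρ ^ ((μ : ℂ) + 1 / 2) *
              (1 - ρ ^ 2) ^ (ν - μ - 1 / 2)) *
          ∑' n : ℕ, ((n : ℂ) + μ) *
            legendreQ (n + μ - 1 / 2) (ν - μ - 1 / 2) ((1 + ρ ^ 2) / (2 * ρ)) *
              gegenbauerC n μ x)) ∧
    -- for `ν = μ` the expansion in `ρ` is, term by term, the generating function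
    (∀ (ρ : ℂ) (x : ℝ), ρ ∈ Complex.slitPlane → ‖ρ‖ < 1 → x ∈ Set.Icc (-1 : ℝ) 1 →
      ∀ n : ℕ,
        Complex.Gamma μ * Complex.exp (Complex.I * Real.pi * ((μ : ℂ) - μ + 1 / 2)) /
            ((Real.sqrt Real.pi : ℂ) * Complex.Gamma μ * ρ ^ ((μ : ℂ) + 1 / 2) *
              (1 - ρ ^ 2) ^ ((μ : ℂ) - μ - 1 / 2)) *
          (((n : ℂ) + μ) *
            legendreQ (n + μ - 1 / 2) ((μ : ℂ) - μ - 1 / 2) ((1 + ρ ^ 2) / (2 * ρ)) *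
              gegenbauerC n μ x) =
        gegenbauerC n μ x * ρ ^ n) ∧
    (∀ (ρ : ℂ) (x : ℝ), ‖ρ‖ < 1 → x ∈ Set.Icc (-1 : ℝ) 1 →
      HasSum (fun n : ℕ => gegenbauerC n μ x * ρ ^ n) (1 / (1 + ρ ^ 2 - 2 * ρ * x) ^ (μ : ℂ))) := by
  have hμr : ∀ k : ℕ, (μ : ℂ) + k ≠ 0 := by
    intro k h
    have h' : μ + k = 0 := by exact_mod_cast h
    rcases Nat.eq_zero_or_pos k with rfl | hk
    · exact hμ0 (by simpa using h')
    · have : (1 : ℝ) ≤ k := by exact_mod_cast hk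
      linarith
  have hμ' : ∀ k : ℕ, (μ : ℂ) + 1 / 2 + k ≠ 0 := by
    intro k h
    have h' := congrArg Complex.re h
    simp at h'
    have : (0 : ℝ) ≤ k := Nat.cast_nonneg k
    linarith
  refine ⟨fun ν hν0 => ?_, fun ρ x hρ hρ1 _ n => ?_, fun ρ x hρ1 hx => ?_⟩
  · have hν : ∀ k : ℕ, ν + k ≠ 0 := fun k h => hν0 k (eq_neg_of_add_eq_zero_left h)
    refine ⟨fun R z x _ hz hzR hx => ?_, fun ρ x hρ hρ1 hx => ?_⟩
    · obtain ⟨ρ, hρ, hρ1, rfl⟩ := exists_eq_joukowski_of_mem_cutPlane hz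
      have hsub := subPow_joukowski hρ hρ1 hzR hx ν
      obtain ⟨w, hw, hw1, rfl⟩ := exists_eq_joukowski x
      have hρ0 := Complex.slitPlane_ne_zero hρ
      have h := hasSum_gegenbauerC_expansion hμr hμ' hν hρ hw hw1
        (norm_lt_of_mem_focalEllipseInterior hρ0 hρ1 hw hzR hx)
      obtain ⟨h1, h2⟩ := summable_and_eq_mul_tsum
        (gegenbauerPrefactor_ne_zero hμr hν hρ0 hρ1) h
      refine ⟨h1, ?_⟩
      rw [prefactor_mul_two_mul_cpow hρ hρ1, mul_assoc, ← h2, hsub, one_div_div, mul_one_div]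
    · obtain ⟨w, hw, hw1, hxw⟩ := exists_norm_eq_one_eq_joukowski hx
      have h := hasSum_gegenbauerC_expansion hμr hμ' hν hρ hw hw1.le (hρ1.trans_eq hw1.symm)
      rw [← hxw] at h
      exact summable_and_eq_mul_tsum
        (gegenbauerPrefactor_ne_zero hμr hν (Complex.slitPlane_ne_zero hρ) hρ1) h
  · exact gegenbauerPrefactor_mul_legendreQ_self hμr hρ hρ1 n _
  · exact hasSum_gegenbauerC_mul_pow hμ' hρ1 hx
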